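/- **Setting.** Let $X$ be a metric space with its Borel $\sigma$-algebra, $\mathcal P(X)$ the set of Borel probability measures on $X$, and $\rho$ the Hellinger distance. Let $\zeta$ be a Borel measure on $X$ that is positive on nonempty open sets; "density" means density with respect to $\zeta$. A *finite mixing measure* is a finitely supported probability distribution $\Omega=\sum_\ell\omega_\ell\delta_{q_\ell}$ on $\mathcal P(X)$ (distinct atoms $q_\ell$, weights $\omega_\ell>0$); its mixture is $m(\Omega)=\sum_\ell\omega_\ell q_\ell$. For $r\ge1$, $W_r$ is the $L_r$-Wasserstein distance between finite mixing measures with respect to $\rho$. For an assignment $\alpha$ of the atoms of $\Omega$ to $\{1,\dots,K\}$ put $\varpi_k(\alpha)=\sum_{\alpha(q_\ell)=k}\omega_\ell$ and $Q_k(\alpha)=\varpi_k(\alpha)^{-1}\sum_{\alpha(q_\ell)=k}\omega_\ell q_\ell$, and let $\Delta_k(\alpha)$ be the $\rho$-diameter of the convex hull of $\{q_\ell:\alpha(q_\ell)=k\}$. Let $(\mathfrak Q_L)_{L\ge 1}$ be families of finite mixing measures such that every $\Omega\in\mathfrak Q_L$ has at most $L$ atoms, $\mathfrak Q_L\subset\mathfrak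 Q_{L+1}$, and $m$ is injective on each $\mathfrak Q_L$. Let $\Lambda=\sum_{k=1}^K\lambda_k\delta_{\gamma_k}$ be a finite mixing measure with exactly $K$ atoms and $\Gamma=m(\Lambda)$. Assume: * *(regularity)* for all large $L$ there is a unique $\rho$-closest point to $\Gamma$ in $m(\mathfrak Q_L)$, with mixing measure $\Omega^*_L\in\mathfrak Q_L$; $\rho(m(\Omega^*_L),\Gamma)\to0$; and $\alpha_L$ are assignments of the atoms of $\Omega^*_L$ to $\{1,\dots,K\}$ with $\rho(Q^*_{k}(\alpha_L),\gamma_k)\to0$ and $\varpi^*_{k}(\alpha_L)\to\lambda_k$ for all $k$ as $L\to\infty$ (starred quantities belong to $\Omega_L^*$); * *(separation)* for some $\xi>0$, $\rho(\gamma_i,\gamma_j)>(4+\xi)\,\eta$ for all $i\neq j$, where $\eta=\limsup_{L\to\infty}\big[\max_k\Delta^*_k(\alpha_L)+\max_k\rho(\gamma_k,Q^*_k(\alpha_L))\big]$; * *(estimators)* $Z^{(1)},Z^{(2)},\dots$ are i.i.d. with law $\Gamma$, and for all large $L$ and all $n$, $\widehat\Omega_{L,n}=\widehat\Omega_{L,n}(Z^{(1)},\dots,Z^{(n)})\in\mathfrak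 Q_L$ has the same number of atoms as $\Omega^*_L$, and for all large $L$, $W_r(\widehat\Omega_{L,n},\Omega^*_L)\to0$ as $n\to\infty$, almost surely (respectively, in probability); * *(clustering)* $\widehat\alpha_{L,n}$ is the assignment obtained by single-linkage clustering of the atoms of $\widehat\Omega_{L,n}$, with distances $\rho$, into $K$ nonempty clusters, whenever the single-linkage dendrogram can be cut into exactly $K$ clusters (and is arbitrary otherwise); * *(equicontinuity)* all atoms of all $\Omega\in\bigcup_L\mathfrak Q_L$ have continuous densities, and these densities form an equicontinuous family of functions on $X$. **Conclusion.** Each $\gamma_k$ has a continuous density $f_k$. Moreover, after a suitable permutation (depending on $L$, $n$ and the sample) of the labels of the clusters of $\widehat\alpha_{L,n}$, the continuous densities $\widehat f_k=\widehat f_{k,L,n}$ of $\widehat Q_k(\widehat\alpha_{L,n})$ satisfy, for every $k$, $\widehat f_k\to f_k$ pointwise on $X$ and uniformly on every compact subset of $X$, almost surely (respectively, in probability), as $L,n\to\infty$. The limit $L,n\to\infty$ is the iterated one, first $n\to\infty$ and then $L\to\infty$: a property holds in the limit if there is $L_0$ such that for each $L\ge L_0$ there is $n_0=n_0(L)$ such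 that it holds for all $n\ge n_0$. -/

import Mathlib

open MeasureTheory ProbabilityTheory Filter Topology
open scoped NNReal ENNReal

noncomputable section

namespace NPMix

variable {X : Type*} [MeasurableSpace X]

/-- The Hellinger distance `ρ(μ, ν) = (½ ∫ (√(dμ/dτ) - √(dν/dτ))² dτ)^{1/2}` of two finite measures,
computed with the dominating measure `τ = μ + ν`. -/
def hellinger (μ ν : Measure X) : ℝ :=
  √(1 / 2 * ∫ x, (√(μ.rnDeriv (μ + ν) x).toReal - √(ν.rnDeriv (μ + ν) x).toReal) ^ 2 ∂(μ + ν))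

/-- A finite mixing measure: a finitely supported probability distribution on the space of
probability measures on `X`. The atoms are the elements of `weight.support`; they are distinct and
have positive weights. -/
@[ext]
structure MixingMeasure (X : Type*) [MeasurableSpace X] where
  weight : ProbabilityMeasure X →₀ ℝ≥0
  sum_weight : ∑ q ∈ weight.support, weight q = 1

/-- The finite set of atoms (the support) of a mixing measure. -/
def MixingMeasure.atoms (Ω : MixingMeasure X) : Finset (ProbabilityMeasure X) := Ω.weight.support

/-- The mixture distribution `m(Ω) = ∑ ω_ℓ q_ℓ`. -/
def MixingMeasure.mix (Ω : MixingMeasure X) : Measure X :=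
  ∑ q ∈ Ω.atoms, Ω.weight q • (q : Measure X)

/-- The `L_r`-Wasserstein distance between finite mixing measures, with respect to the Hellinger
distance on atoms: the infimum over all couplings `σ` of the two weight vectors. -/
def wasserstein (r : ℝ) (Ω Ω' : MixingMeasure X) : ℝ :=
  sInf {c | ∃ σ : ProbabilityMeasure X → ProbabilityMeasure X → ℝ,
    (∀ p q, 0 ≤ σ p q) ∧
    (∀ p ∈ Ω.atoms, ∑ q ∈ Ω'.atoms, σ p q = Ω.weight p) ∧
    (∀ q ∈ Ω'.atoms, ∑ p ∈ Ω.atoms, σ p q = Ω'.weight q) ∧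
    c = (∑ p ∈ Ω.atoms, ∑ q ∈ Ω'.atoms, σ p q * hellinger (p : Measure X) q ^ r) ^ (1 / r)}

/-- The approximating families: `𝔔_L` consists of mixing measures with at most `L` atoms, the
families increase with `L`, and the mixture models `M(𝔔_L)` are identifiable. -/
structure IsApproximatingFamily (𝔔 : ℕ → Set (MixingMeasure X)) : Prop where
  card_atoms_le : ∀ L, ∀ Ω ∈ 𝔔 L, Ω.atoms.card ≤ L
  mono : ∀ L, 𝔔 L ⊆ 𝔔 (L + 1)
  identifiable : ∀ L, Set.InjOn MixingMeasure.mix (𝔔 L)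

/-- The (set-valued) Hellinger projection `T Γ` of `Γ` onto the mixture model `M(𝔔)`. -/
def hellingerProj (𝔔 : Set (MixingMeasure X)) (Γ : Measure X) : Set (Measure X) :=
  {Q | Q ∈ MixingMeasure.mix '' 𝔔 ∧
    ∀ P ∈ MixingMeasure.mix '' 𝔔, hellinger Q Γ ≤ hellinger P Γ}

/-- The Hellinger projection of `Γ` onto `M(𝔔)` exists and is unique, and `Ω ∈ 𝔔` is its mixing
measure. -/
def IsProjMixing (𝔔 : Set (MixingMeasure X)) (Γ : Measure X) (Ω : MixingMeasure X) : Prop :=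
  Ω ∈ 𝔔 ∧ hellingerProj 𝔔 Γ = {Ω.mix}

section Clusters

variable {K : ℕ}

/-- The atoms of `Ω` in cluster `k`. An assignment of the atoms of `Ω` to `K` clusters is given by a
map `α` into `Fin K`, of which only the values at the atoms of `Ω` are ever used. -/
def clusterAtoms (Ω : MixingMeasure X) (α : ProbabilityMeasure X → Fin K) (k : Fin K) :
    Finset (ProbabilityMeasure X) :=
  Ω.atoms.filter (fun q => α q = k)

/-- The total weight of cluster `k`. -/
def clusterWeight (Ω : MixingMeasure X) (α : ProbabilityMeasure X → Fin K) (k : Fin K) : ℝ≥0 :=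
  ∑ q ∈ clusterAtoms Ω α k, Ω.weight q

/-- The clustered component `Q_k(α)`, the normalized sub-mixture of the atoms in cluster `k`. -/
def clusterMeasure (Ω : MixingMeasure X) (α : ProbabilityMeasure X → Fin K) (k : Fin K) :
    Measure X :=
  (clusterWeight Ω α k)⁻¹ • ∑ q ∈ clusterAtoms Ω α k, Ω.weight q • (q : Measure X)

/-- The Hellinger diameter of the convex hull of a finite set of probability measures. -/
def hellingerDiam (S : Finset (ProbabilityMeasure X)) : ℝ :=
  sSup {d | ∃ P ∈ convexHull ℝ≥0 ((fun q : ProbabilityMeasure X => (q : Measure X)) '' S),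
    ∃ P' ∈ convexHull ℝ≥0 ((fun q : ProbabilityMeasure X => (q : Measure X)) '' S),
      d = hellinger P P'}

/-- `η(α) = sup_k Δ(Ω_k(α)) + sup_k ρ(γ_k, Q_k(α))`. -/
def eta (γ : Fin K → ProbabilityMeasure X) (Ω : MixingMeasure X)
    (α : ProbabilityMeasure X → Fin K) : ℝ :=
  (⨆ k, hellingerDiam (clusterAtoms Ω α k)) +
    ⨆ k, hellinger (γ k : Measure X) (clusterMeasure Ω α k)

/-- `Λ` is `δ`-separated: distinct atoms have Hellinger distance greater than `δ`. -/
def IsSeparated (Λ : MixingMeasure X) (δ : ℝ) : Prop :=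
  ∀ p ∈ Λ.atoms, ∀ q ∈ Λ.atoms, p ≠ q → δ < hellinger (p : Measure X) q

/-- `γ_1, …, γ_K` is an enumeration, without repetition, of the atoms of `Λ`. -/
def IsEnumeration (Λ : MixingMeasure X) (γ : Fin K → ProbabilityMeasure X) : Prop :=
  Function.Injective γ ∧ Set.range γ = Λ.atoms

/-- `Λ`, with atoms `γ_k`, is regular for the families `𝔔_L`: for all large `L` the Hellinger
projection of `m(Λ)` onto `M(𝔔_L)` exists, is unique and has mixing measure `Ωs L`, it converges to
`m(Λ)`, and `α` is a regular assignment sequence for `Λ`. -/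
structure IsRegularWith (𝔔 : ℕ → Set (MixingMeasure X)) (Λ : MixingMeasure X)
    (γ : Fin K → ProbabilityMeasure X) (Ωs : ℕ → MixingMeasure X)
    (α : ℕ → ProbabilityMeasure X → Fin K) : Prop where
  proj : ∀ᶠ L in atTop, IsProjMixing (𝔔 L) Λ.mix (Ωs L)
  proj_tendsto : Tendsto (fun L => hellinger (Ωs L).mix Λ.mix) atTop (𝓝 0)
  component_tendsto : ∀ k,
    Tendsto (fun L => hellinger (clusterMeasure (Ωs L) (α L) k) (γ k : Measure X)) atTop (𝓝 0)
  weight_tendsto : ∀ k,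
    Tendsto (fun L => clusterWeight (Ωs L) (α L) k) atTop (𝓝 (Λ.weight (γ k)))

/-- Two atoms are linked at level `t` if a chain of atoms of `S` joins them whose consecutive members
have Hellinger distance at most `t`. -/
def Linked (S : Finset (ProbabilityMeasure X)) (t : ℝ) : ProbabilityMeasure X →
    ProbabilityMeasure X → Prop :=
  Relation.ReflTransGen fun p q => p ∈ S ∧ q ∈ S ∧ hellinger (p : Measure X) q ≤ t

/-- `β` is a single-linkage clustering of the atoms of `Ω` into `K` clusters: its `K` clusters are
nonempty and are those obtained by cutting the single-linkage dendrogram of the Hellinger distance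
matrix of the atoms at some level `t`. -/
def IsSingleLinkage (Ω : MixingMeasure X) (β : ProbabilityMeasure X → Fin K) : Prop :=
  (∀ k, ∃ q ∈ Ω.atoms, β q = k) ∧
    ∃ t : ℝ, ∀ p ∈ Ω.atoms, ∀ q ∈ Ω.atoms, β p = β q ↔ Linked Ω.atoms t p q

end Clusters

section Density

variable [TopologicalSpace X]

/-- `f` is a continuous (nonnegative) density of `μ` with respect to the base measure `ζ`. -/
structure IsContDensity (ζ μ : Measure X) (f : X → ℝ) : Prop where
  continuous : Continuous f
  nonneg : ∀ x, 0 ≤ f x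
  eq_withDensity : μ = ζ.withDensity fun x => ENNReal.ofReal (f x)

/-- Every atom occurring in one of the families `𝔔_L` has a continuous density with respect to `ζ`,
and the densities of all these atoms form an equicontinuous family. -/
def IsEquicontinuousFamily (ζ : Measure X) (𝔔 : ℕ → Set (MixingMeasure X)) : Prop :=
  (∀ L, ∀ Ω ∈ 𝔔 L, ∀ q ∈ Ω.atoms, ∃ f, IsContDensity ζ (q : Measure X) f) ∧
    Set.Equicontinuous
      {f : X → ℝ | ∃ L, ∃ Ω ∈ 𝔔 L, ∃ q ∈ Ω.atoms, IsContDensity ζ (q : Measure X) f}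

open Classical in
/-- The continuous density of `μ` with respect to `ζ` (zero if there is none). -/
def contDensity (ζ μ : Measure X) : X → ℝ :=
  if h : ∃ f, IsContDensity ζ μ f then h.choose else 0

/-- With respect to a base measure of full support, the continuous density is unique. -/
theorem IsContDensity.eq_contDensity [OpensMeasurableSpace X] {ζ μ : Measure X}
    [ζ.IsOpenPosMeasure] [IsFiniteMeasure μ] {f : X → ℝ} (hf : IsContDensity ζ μ f) :
    f = contDensity ζ μ := by
  have h : ∃ f, IsContDensity ζ μ f := ⟨f, hf⟩
  have hg : IsContDensity ζ μ (contDensity ζ μ) := by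
    rw [contDensity, dif_pos h]
    exact h.choose_spec
  have mf := hf.continuous.measurable.ennreal_ofReal
  have mg := hg.continuous.measurable.ennreal_ofReal
  have hfin : ∫⁻ x, ENNReal.ofReal (f x) ∂ζ ≠ ∞ := by
    rw [← setLIntegral_univ, ← withDensity_apply _ MeasurableSet.univ, ← hf.eq_withDensity]
    exact measure_ne_top _ _
  have key := (withDensity_eq_iff mf.aemeasurable mg.aemeasurable hfin).1
    (hf.eq_withDensity.symm.trans hg.eq_withDensity)
  have hae : f =ᵐ[ζ] contDensity ζ μ := by
    filter_upwards [key] with x hx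
    exact (ENNReal.ofReal_eq_ofReal_iff (hf.nonneg x) (hg.nonneg x)).1 hx
  exact (Continuous.ae_eq_iff_eq ζ hf.continuous hg.continuous).1 hae

end Density

end NPMix

end

noncomputable section

namespace NPMix

variable {X : Type*} [MeasurableSpace X]

/-! ### The Hellinger distance -/

/-! The argument is deterministic once `L` is fixed, and it runs in total variation, which is at
most four times ρ. For large `L` the separation gives 4η_L < ρ(γ_i, γ_j), where η_L = `eta γ (Ωs L)
(α L)`. Atoms of Ω*_L in one cluster are at most η_L apart. Each atom is also within η_L of its own
γ_k, because Q*_k lies in the convex hull of the cluster, so atoms of different clusters are more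
than η_L apart. A mixing measure with the same number of atoms and small W_r distance to Ω*_L has
atoms and weights matched one to one with those of Ω*_L (`exists_matching`). The gap therefore
survives, single linkage returns the matched partition up to labels, and the estimated component is
close to Q*_k, hence to γ_k (`exists_wasserstein_cluster_close`).

Densities of clustered components are convex combinations of atom densities and inherit their
equicontinuity. As ζ charges open sets, a gap between two such densities at a point persists on a
neighbourhood and costs total variation, so closeness in total variation forces uniform closeness on
compact sets (`exists_density_close_of_isCompact`). The same estimate makes the densities of Q*_k
pointwise Cauchy, and by Fatou's lemma their limit is a density of γ_k
(`exists_isContDensity_of_tendsto`).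

Each large `L` thus has a threshold for W_r, independent of `n` and of the sample, below which the
density error is less than ε. Both modes of convergence follow. -/

theorem sqrt_integral_sub_sq_eq_dist {τ : Measure X} {f g : X → ℝ} (hf : MemLp f 2 τ)
    (hg : MemLp g 2 τ) : √(∫ x, (f x - g x) ^ 2 ∂τ) = dist (hf.toLp f) (hg.toLp g) := by
  rw [dist_eq_norm, ← MemLp.toLp_sub, Lp.norm_toLp,
    (hf.sub hg).eLpNorm_eq_integral_rpow_norm (by norm_num) (by norm_num),
    ENNReal.toReal_ofReal (by positivity), Real.sqrt_eq_rpow]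
  simp

/-- The square root of the Radon-Nikodym density. -/
def sqrtDensity (μ τ : Measure X) (x : X) : ℝ := √(μ.rnDeriv τ x).toReal

theorem sqrtDensity_nonneg (μ τ : Measure X) (x : X) : 0 ≤ sqrtDensity μ τ x := Real.sqrt_nonneg _

theorem sqrtDensity_sq (μ τ : Measure X) (x : X) :
    sqrtDensity μ τ x ^ 2 = (μ.rnDeriv τ x).toReal :=
  Real.sq_sqrt ENNReal.toReal_nonneg

theorem measurable_sqrtDensity (μ τ : Measure X) : Measurable (sqrtDensity μ τ) :=
  (Measure.measurable_rnDeriv μ τ).ennreal_toReal.sqrt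

theorem memLp_sqrtDensity (μ τ : Measure X) [IsFiniteMeasure μ] : MemLp (sqrtDensity μ τ) 2 τ := by
  rw [memLp_two_iff_integrable_sq (measurable_sqrtDensity μ τ).aestronglyMeasurable]
  simp_rw [sqrtDensity_sq]
  exact Measure.integrable_toReal_rnDeriv

/-- The Hellinger distance can be computed with any dominating measure. -/
theorem hellinger_eq_of_absolutelyContinuous (μ ν τ : Measure X) [IsFiniteMeasure μ]
    [IsFiniteMeasure ν] [IsFiniteMeasure τ] (hμ : μ ≪ τ) (hν : ν ≪ τ) :
    hellinger μ ν = √(1 / 2 * ∫ x, (sqrtDensity μ τ x - sqrtDensity ν τ x) ^ 2 ∂τ) := by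
  unfold hellinger
  have hκ : μ + ν ≪ τ := Measure.AbsolutelyContinuous.add_left hμ hν
  have h1 : μ ≪ μ + ν := Measure.absolutelyContinuous_of_le (Measure.le_add_right le_rfl)
  have h2 : ν ≪ μ + ν := Measure.absolutelyContinuous_of_le (Measure.le_add_left le_rfl)
  congr 2
  -- Chain rule through κ = μ + ν: both densities acquire the common factor dκ/dτ, which leaves the
  -- squared difference of roots linearly.
  rw [← integral_rnDeriv_smul hκ]
  refine integral_congr_ae ?_
  filter_upwards [Measure.rnDeriv_mul_rnDeriv (κ := τ) h1,
    Measure.rnDeriv_mul_rnDeriv (κ := τ) h2] with x hx1 hx2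
  simp only [sqrtDensity, ← hx1, ← hx2, Pi.mul_apply, ENNReal.toReal_mul, smul_eq_mul]
  rw [Real.sqrt_mul ENNReal.toReal_nonneg, Real.sqrt_mul ENNReal.toReal_nonneg, ← sub_mul, mul_pow,
    Real.sq_sqrt ENNReal.toReal_nonneg, mul_comm]

theorem hellinger_nonneg (μ ν : Measure X) : 0 ≤ hellinger μ ν := Real.sqrt_nonneg _

theorem hellinger_comm (μ ν : Measure X) : hellinger μ ν = hellinger ν μ := by
  unfold hellinger
  rw [add_comm ν μ]
  simp_rw [sub_sq_comm]

/-- With one dominating measure for all three, ρ is √(1/2) times the L² distance of root densities.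
-/
theorem hellinger_triangle (μ ν κ : Measure X) [IsFiniteMeasure μ] [IsFiniteMeasure ν]
    [IsFiniteMeasure κ] : hellinger μ κ ≤ hellinger μ ν + hellinger ν κ := by
  have h1 : μ ≪ μ + ν + κ :=
    Measure.absolutelyContinuous_of_le (by rw [add_assoc]; exact Measure.le_add_right le_rfl)
  have h2 : ν ≪ μ + ν + κ := Measure.absolutelyContinuous_of_le
    (Measure.le_add_right (Measure.le_add_left le_rfl))
  have h3 : κ ≪ μ + ν + κ := Measure.absolutelyContinuous_of_le (Measure.le_add_left le_rfl)
  rw [hellinger_eq_of_absolutelyContinuous μ κ _ h1 h3,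
    hellinger_eq_of_absolutelyContinuous μ ν _ h1 h2,
    hellinger_eq_of_absolutelyContinuous ν κ _ h2 h3]
  rw [Real.sqrt_mul (by norm_num), Real.sqrt_mul (by norm_num), Real.sqrt_mul (by norm_num),
    sqrt_integral_sub_sq_eq_dist (memLp_sqrtDensity _ _) (memLp_sqrtDensity _ _),
    sqrt_integral_sub_sq_eq_dist (memLp_sqrtDensity _ _) (memLp_sqrtDensity _ _),
    sqrt_integral_sub_sq_eq_dist (memLp_sqrtDensity _ _) (memLp_sqrtDensity _ _), ← mul_add]
  exact mul_le_mul_of_nonneg_left (dist_triangle _ _ _) (Real.sqrt_nonneg _)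

theorem hellinger_le (μ ν : Measure X) [IsFiniteMeasure μ] [IsFiniteMeasure ν] :
    hellinger μ ν ≤ √(1 / 2 * (μ.real Set.univ + ν.real Set.univ)) := by
  have h1 : μ ≪ μ + ν := Measure.absolutelyContinuous_of_le (Measure.le_add_right le_rfl)
  have h2 : ν ≪ μ + ν := Measure.absolutelyContinuous_of_le (Measure.le_add_left le_rfl)
  refine Real.sqrt_le_sqrt (mul_le_mul_of_nonneg_left ?_ (by norm_num))
  rw [← Measure.integral_toReal_rnDeriv h1, ← Measure.integral_toReal_rnDeriv h2,
    ← integral_add Measure.integrable_toReal_rnDeriv Measure.integrable_toReal_rnDeriv]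
  refine integral_mono
    (((memLp_sqrtDensity μ (μ + ν)).sub (memLp_sqrtDensity ν (μ + ν))).integrable_sq)
    (Measure.integrable_toReal_rnDeriv.add Measure.integrable_toReal_rnDeriv) fun x => ?_
  change (sqrtDensity μ (μ + ν) x - sqrtDensity ν (μ + ν) x) ^ 2 ≤ _
  simp only [← sqrtDensity_sq]
  nlinarith [sqrtDensity_nonneg μ (μ + ν) x, sqrtDensity_nonneg ν (μ + ν) x,
    mul_nonneg (sqrtDensity_nonneg μ (μ + ν) x) (sqrtDensity_nonneg ν (μ + ν) x)]

/-- Mass at most one is allowed because the component of an empty cluster is the zero measure. -/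
theorem hellinger_le_one {μ ν : Measure X} [IsFiniteMeasure μ] [IsFiniteMeasure ν]
    (hμ : μ.real Set.univ ≤ 1) (hν : ν.real Set.univ ≤ 1) : hellinger μ ν ≤ 1 :=
  (hellinger_le μ ν).trans (Real.sqrt_le_one.2 (by linarith))

/-! ### The total variation distance -/

/-- The total variation distance `sup_A |μ(A) - ν(A)|`. -/
def tvDist (μ ν : Measure X) : ℝ := ⨆ A : {A : Set X // MeasurableSet A}, |μ.real A - ν.real A|

theorem tvDist_le {μ ν : Measure X} {c : ℝ}
    (h : ∀ A, MeasurableSet A → |μ.real A - ν.real A| ≤ c) : tvDist μ ν ≤ c :=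
  have : Nonempty {A : Set X // MeasurableSet A} := ⟨⟨∅, MeasurableSet.empty⟩⟩
  ciSup_le fun A => h A A.2

theorem abs_real_sub_le_tvDist (μ ν : Measure X) [IsFiniteMeasure μ] [IsFiniteMeasure ν] {A : Set X}
    (hA : MeasurableSet A) : |μ.real A - ν.real A| ≤ tvDist μ ν := by
  refine le_ciSup (f := fun A : {A : Set X // MeasurableSet A} => |μ.real A - ν.real A|)
    ⟨μ.real Set.univ + ν.real Set.univ, ?_⟩ ⟨A, hA⟩
  rintro _ ⟨B, rfl⟩
  have h1 : μ.real B ≤ μ.real Set.univ := measureReal_mono (Set.subset_univ _)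
  have h2 : ν.real B ≤ ν.real Set.univ := measureReal_mono (Set.subset_univ _)
  have h3 : 0 ≤ μ.real B := measureReal_nonneg
  have h4 : 0 ≤ ν.real B := measureReal_nonneg
  exact abs_le.2 ⟨by linarith, by linarith⟩

theorem tvDist_nonneg (μ ν : Measure X) : 0 ≤ tvDist μ ν :=
  Real.iSup_nonneg fun _ => abs_nonneg _

theorem tvDist_comm (μ ν : Measure X) : tvDist μ ν = tvDist ν μ := by
  unfold tvDist
  simp_rw [abs_sub_comm]

theorem tvDist_triangle (μ ν κ : Measure X) [IsFiniteMeasure μ] [IsFiniteMeasure ν]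
    [IsFiniteMeasure κ] : tvDist μ κ ≤ tvDist μ ν + tvDist ν κ :=
  tvDist_le fun _ hA => (abs_sub_le _ _ _).trans
    (add_le_add (abs_real_sub_le_tvDist μ ν hA) (abs_real_sub_le_tvDist ν κ hA))

theorem eq_of_tvDist_eq_zero {μ ν : Measure X} [IsFiniteMeasure μ] [IsFiniteMeasure ν]
    (h : tvDist μ ν = 0) : μ = ν := by
  ext A hA
  have := abs_real_sub_le_tvDist μ ν hA
  rw [h, abs_nonpos_iff, sub_eq_zero] at this
  exact (measureReal_eq_measureReal_iff).1 this

/-- With f, g the root densities, |f² - g²| = |f - g|(f + g); apply Cauchy–Schwarz with ‖f + g‖₂ ≤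
2. The constant 4 comes from the crude bound √(1/2) ≥ 1/2. -/
theorem tvDist_le_hellinger (μ ν : Measure X) [IsProbabilityMeasure μ] [IsProbabilityMeasure ν] :
    tvDist μ ν ≤ 4 * hellinger μ ν := by
  have h1 : μ ≪ μ + ν := Measure.absolutelyContinuous_of_le (Measure.le_add_right le_rfl)
  have h2 : ν ≪ μ + ν := Measure.absolutelyContinuous_of_le (Measure.le_add_left le_rfl)
  set τ := μ + ν with hτ
  have mf := memLp_sqrtDensity μ τ
  have mg := memLp_sqrtDensity ν τ
  set f := sqrtDensity μ τ with hf
  set g := sqrtDensity ν τ with hg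
  have hρ : hellinger μ ν = √(1 / 2 * ∫ x, (f x - g x) ^ 2 ∂τ) := rfl
  have hint : Integrable (fun x => |f x - g x| * (f x + g x)) τ :=
    (mf.sub mg).abs.integrable_mul (mf.add mg)
  have hf1 : ∫ x, f x ^ 2 ∂τ = 1 := by
    simp_rw [hf, sqrtDensity_sq]
    rw [Measure.integral_toReal_rnDeriv h1, probReal_univ]
  have hg1 : ∫ x, g x ^ 2 ∂τ = 1 := by
    simp_rw [hg, sqrtDensity_sq]
    rw [Measure.integral_toReal_rnDeriv h2, probReal_univ]
  have hsum : ∫ x, (f x + g x) ^ 2 ∂τ ≤ 4 := by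
    calc ∫ x, (f x + g x) ^ 2 ∂τ ≤ ∫ x, (2 * f x ^ 2 + 2 * g x ^ 2) ∂τ := by
          refine integral_mono (mf.add mg).integrable_sq
            ((mf.integrable_sq.const_mul 2).add (mg.integrable_sq.const_mul 2)) fun x => ?_
          change (f x + g x) ^ 2 ≤ 2 * f x ^ 2 + 2 * g x ^ 2
          nlinarith [sq_nonneg (f x - g x)]
      _ = 4 := by
          rw [integral_add (mf.integrable_sq.const_mul 2) (mg.integrable_sq.const_mul 2),
            integral_const_mul, integral_const_mul, hf1, hg1]
          norm_num
  have hI0 : 0 ≤ ∫ x, (f x - g x) ^ 2 ∂τ := integral_nonneg fun x => sq_nonneg _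
  have hCS : ∫ x, |f x - g x| * (f x + g x) ∂τ ≤ 4 * hellinger μ ν := by
    have := integral_mul_le_Lp_mul_Lq_of_nonneg (μ := τ) Real.HolderConjugate.two_two
      (f := fun x => |f x - g x|) (g := fun x => f x + g x)
      (Eventually.of_forall fun x => abs_nonneg _)
      (Eventually.of_forall fun x => add_nonneg (sqrtDensity_nonneg _ _ _) (sqrtDensity_nonneg _ _ _))
      (by rw [ENNReal.ofReal_ofNat]; exact (mf.sub mg).abs)
      (by rw [ENNReal.ofReal_ofNat]; exact mf.add mg)
    refine this.trans ?_
    simp only [Real.rpow_two, sq_abs, ← Real.sqrt_eq_rpow]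
    rw [hρ, Real.sqrt_mul (by norm_num)]
    have h4 : √(∫ x, (f x + g x) ^ 2 ∂τ) ≤ 2 := Real.sqrt_le_iff.2 ⟨by norm_num, by linarith⟩
    have h5 : 1 / 2 ≤ √(1 / 2 : ℝ) := Real.le_sqrt_of_sq_le (by norm_num)
    nlinarith [Real.sqrt_nonneg (∫ x, (f x - g x) ^ 2 ∂τ),
      mul_le_mul_of_nonneg_left h4 (Real.sqrt_nonneg (∫ x, (f x - g x) ^ 2 ∂τ)),
      mul_le_mul_of_nonneg_left h5 (Real.sqrt_nonneg (∫ x, (f x - g x) ^ 2 ∂τ))]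
  refine tvDist_le fun A hA => le_trans ?_ hCS
  rw [← Measure.setIntegral_toReal_rnDeriv h1, ← Measure.setIntegral_toReal_rnDeriv h2,
    ← integral_sub Measure.integrable_toReal_rnDeriv.integrableOn
      Measure.integrable_toReal_rnDeriv.integrableOn]
  calc |∫ x in A, ((μ.rnDeriv τ x).toReal - (ν.rnDeriv τ x).toReal) ∂τ|
      ≤ ∫ x in A, |(μ.rnDeriv τ x).toReal - (ν.rnDeriv τ x).toReal| ∂τ :=
        abs_integral_le_integral_abs
    _ = ∫ x in A, |f x - g x| * (f x + g x) ∂τ := by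
        refine integral_congr_ae (Eventually.of_forall fun x => ?_)
        have h0 : 0 ≤ f x + g x := add_nonneg (sqrtDensity_nonneg _ _ _) (sqrtDensity_nonneg _ _ _)
        simp only [← sqrtDensity_sq]
        rw [sq_sub_sq, abs_mul, abs_of_nonneg h0, mul_comm]
    _ ≤ ∫ x, |f x - g x| * (f x + g x) ∂τ :=
        setIntegral_le_integral hint (Eventually.of_forall fun x =>
          mul_nonneg (abs_nonneg _) (add_nonneg (sqrtDensity_nonneg _ _ _) (sqrtDensity_nonneg _ _ _)))

theorem hellinger_pos {p q : ProbabilityMeasure X} (h : p ≠ q) :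
    0 < hellinger (p : Measure X) q := by
  refine (hellinger_nonneg _ _).lt_of_ne fun h0 => h ?_
  have := tvDist_le_hellinger (p : Measure X) q
  rw [← h0, mul_zero] at this
  exact ProbabilityMeasure.toMeasure_injective (eq_of_tvDist_eq_zero (this.antisymm (tvDist_nonneg _ _)))

/-! ### Continuous densities -/

section Density

variable [TopologicalSpace X] {ζ : Measure X}

theorem isContDensity_contDensity {μ : Measure X} (h : ∃ f, IsContDensity ζ μ f) :
    IsContDensity ζ μ (contDensity ζ μ) := by
  rw [contDensity, dif_pos h]
  exact h.choose_spec

theorem IsContDensity.apply {μ : Measure X} {f : X → ℝ} (hf : IsContDensity ζ μ f) {A : Set X}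
    (hA : MeasurableSet A) : μ A = ∫⁻ x in A, ENNReal.ofReal (f x) ∂ζ := by
  conv_lhs => rw [hf.eq_withDensity]
  exact withDensity_apply _ hA

theorem isContDensity_zero : IsContDensity ζ 0 (0 : X → ℝ) where
  continuous := continuous_zero
  nonneg _ := le_rfl
  eq_withDensity := by simp

variable [OpensMeasurableSpace X]

theorem IsContDensity.measurable {μ : Measure X} {f : X → ℝ} (hf : IsContDensity ζ μ f) :
    Measurable fun x => ENNReal.ofReal (f x) :=
  hf.continuous.measurable.ennreal_ofReal

theorem IsContDensity.add {μ ν : Measure X} {f g : X → ℝ} (hf : IsContDensity ζ μ f)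
    (hg : IsContDensity ζ ν g) : IsContDensity ζ (μ + ν) (f + g) where
  continuous := hf.continuous.add hg.continuous
  nonneg x := add_nonneg (hf.nonneg x) (hg.nonneg x)
  eq_withDensity := by
    conv_lhs => rw [hf.eq_withDensity, hg.eq_withDensity]
    rw [← withDensity_add_left hf.measurable]
    congr 1
    ext x
    exact (ENNReal.ofReal_add (hf.nonneg x) (hg.nonneg x)).symm

theorem IsContDensity.smul {μ : Measure X} {f : X → ℝ} (hf : IsContDensity ζ μ f) (c : ℝ≥0) :
    IsContDensity ζ (c • μ) ((c : ℝ) • f) where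
  continuous := hf.continuous.const_smul _
  nonneg x := mul_nonneg c.2 (hf.nonneg x)
  eq_withDensity := by
    conv_lhs => rw [hf.eq_withDensity]
    change (c : ℝ≥0∞) • ζ.withDensity (fun x => ENNReal.ofReal (f x)) = _
    rw [← withDensity_smul _ hf.measurable]
    congr 1
    ext x
    simp [ENNReal.ofReal_mul]

theorem IsContDensity.sum {ι : Type*} (s : Finset ι) {μ : ι → Measure X} {f : ι → X → ℝ}
    (h : ∀ i ∈ s, IsContDensity ζ (μ i) (f i)) :
    IsContDensity ζ (∑ i ∈ s, μ i) (∑ i ∈ s, f i) := by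
  classical
  induction s using Finset.induction_on with
  | empty => simpa using isContDensity_zero
  | insert a s ha ih =>
    rw [Finset.sum_insert ha, Finset.sum_insert ha]
    exact (h a (Finset.mem_insert_self a s)).add
      (ih fun i hi => h i (Finset.mem_insert_of_mem hi))

/-- If one density exceeds another one by `e` on a set `V`, then the total variation distance of the
measures is at least `e ζ(V)`. -/
theorem IsContDensity.mul_le_tvDist {μ ν : Measure X} [IsFiniteMeasure μ] [IsFiniteMeasure ν]
    {f g : X → ℝ} (hf : IsContDensity ζ μ f) (hg : IsContDensity ζ ν g) {V : Set X}
    (hV : MeasurableSet V) {e : ℝ} (he : 0 ≤ e) (h : ∀ y ∈ V, g y + e ≤ f y) :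
    ENNReal.ofReal e * ζ V ≤ ENNReal.ofReal (tvDist μ ν) := by
  have h1 : ν V + ENNReal.ofReal e * ζ V ≤ μ V := by
    rw [hf.apply hV, hg.apply hV, ← setLIntegral_const, ← lintegral_add_left hg.measurable]
    refine setLIntegral_mono hf.measurable fun y hy => ?_
    rw [← ENNReal.ofReal_add (hg.nonneg y) he]
    exact ENNReal.ofReal_le_ofReal (h y hy)
  have h2 : ENNReal.ofReal e * ζ V ≤ μ V - ν V :=
    ENNReal.le_sub_of_add_le_left (measure_ne_top _ _) h1
  refine h2.trans ?_
  rw [← ofReal_measureReal (μ := μ), ← ofReal_measureReal (μ := ν),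
    ← ENNReal.ofReal_sub _ measureReal_nonneg]
  exact ENNReal.ofReal_le_ofReal ((le_abs_self _).trans (abs_real_sub_le_tvDist μ ν hV))

/-- Within an equicontinuous family, densities of measures that are close in total variation are
locally uniformly close. -/
theorem exists_nhds_density_close [ζ.IsOpenPosMeasure] {S : Set (X → ℝ)}
    (hS : S.Equicontinuous) (x : X) {ε : ℝ} (hε : 0 < ε) :
    ∃ U ∈ 𝓝 x, ∃ δ > 0, ∀ (μ ν : Measure X) [IsFiniteMeasure μ] [IsFiniteMeasure ν],
      ∀ f ∈ S, ∀ g ∈ S, IsContDensity ζ μ f → IsContDensity ζ ν g → tvDist μ ν < δ →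
        ∀ y ∈ U, |f y - g y| < ε := by
  -- Each density varies by less than ε/5 on `V`. A gap of 3ε/5 at `x` would leave at least ε/5
  -- throughout `V`; otherwise the gap on `V` is below (3 + 2)ε/5.
  have hε5 : 0 < ε / 5 := by positivity
  have hev := Metric.equicontinuousAt_iff_right.1 (hS x) (ε / 5) hε5
  obtain ⟨V, hVsub, hVo, hxV⟩ := mem_nhds_iff.1 hev
  have hVf : ∀ f ∈ S, ∀ y ∈ V, |f x - f y| < ε / 5 := fun f hf y hy => hVsub hy ⟨f, hf⟩
  have hpos : 0 < ENNReal.ofReal (ε / 5) * ζ V :=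
    ENNReal.mul_pos (ENNReal.ofReal_pos.2 hε5).ne' (hVo.measure_pos ζ ⟨x, hxV⟩).ne'
  -- ζ(V) may be infinite, so a finite threshold is chosen strictly below the product.
  obtain ⟨δ, hδ0, hδ⟩ := ENNReal.lt_iff_exists_nnreal_btwn.1 hpos
  have key : ∀ (μ ν : Measure X) [IsFiniteMeasure μ] [IsFiniteMeasure ν],
      ∀ f ∈ S, ∀ g ∈ S, IsContDensity ζ μ f → IsContDensity ζ ν g → tvDist μ ν < δ →
        f x - g x < 3 * (ε / 5) := by
    intro μ ν _ _ f hf g hg hμ hν htv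
    by_contra! hcon
    have := hμ.mul_le_tvDist hν hVo.measurableSet hε5.le fun y hy => by
      have h1 := abs_lt.1 (hVf f hf y hy)
      have h2 := abs_lt.1 (hVf g hg y hy)
      linarith
    have h3 : ENNReal.ofReal (tvDist μ ν) ≤ δ := by
      rw [← ENNReal.ofReal_coe_nnreal]
      exact ENNReal.ofReal_le_ofReal htv.le
    exact absurd (hδ.trans_le (this.trans h3)) (lt_irrefl _)
  refine ⟨V, hVo.mem_nhds hxV, δ, by exact_mod_cast hδ0, ?_⟩
  intro μ ν _ _ f hf g hg hμ hν htv y hy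
  have h1 := abs_lt.1 (hVf f hf y hy)
  have h2 := abs_lt.1 (hVf g hg y hy)
  have h3 := key μ ν f hf g hg hμ hν htv
  have h4 := key ν μ g hg f hf hν hμ (by rwa [tvDist_comm])
  exact abs_lt.2 ⟨by linarith, by linarith⟩

theorem exists_density_close_of_isCompact [ζ.IsOpenPosMeasure] {S : Set (X → ℝ)}
    (hS : S.Equicontinuous) {C : Set X} (hC : IsCompact C) {ε : ℝ} (hε : 0 < ε) :
    ∃ δ > 0, ∀ (μ ν : Measure X) [IsFiniteMeasure μ] [IsFiniteMeasure ν],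
      ∀ f ∈ S, ∀ g ∈ S, IsContDensity ζ μ f → IsContDensity ζ ν g → tvDist μ ν < δ →
        ∀ y ∈ C, |f y - g y| < ε := by
  refine hC.induction_on (p := fun C => ∃ δ > 0, ∀ (μ ν : Measure X) [IsFiniteMeasure μ]
    [IsFiniteMeasure ν], ∀ f ∈ S, ∀ g ∈ S, IsContDensity ζ μ f → IsContDensity ζ ν g →
      tvDist μ ν < δ → ∀ y ∈ C, |f y - g y| < ε) ?_ ?_ ?_ ?_
  · exact ⟨1, one_pos, fun _ _ _ _ _ _ _ _ _ _ _ y hy => absurd hy (Set.notMem_empty y)⟩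
  · rintro s t hst ⟨δ, hδ, h⟩
    exact ⟨δ, hδ, fun μ ν _ _ f hf g hg hμ hν htv y hy =>
      h μ ν f hf g hg hμ hν htv y (hst hy)⟩
  · rintro s t ⟨δ, hδ, h⟩ ⟨δ', hδ', h'⟩
    refine ⟨min δ δ', lt_min hδ hδ', fun μ ν _ _ f hf g hg hμ hν htv y hy => ?_⟩
    rcases hy with hy | hy
    · exact h μ ν f hf g hg hμ hν (htv.trans_le (min_le_left _ _)) y hy
    · exact h' μ ν f hf g hg hμ hν (htv.trans_le (min_le_right _ _)) y hy
  · intro x _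
    obtain ⟨U, hU, h⟩ := exists_nhds_density_close (ζ := ζ) hS x hε
    exact ⟨U, mem_nhdsWithin_of_mem_nhds hU, h⟩

/-- The integral of the positive part of f - g is the excess of μ over ν on the set {g ≤ f}. -/
theorem lintegral_ofReal_sub_le_tvDist {μ ν : Measure X} [IsFiniteMeasure μ] [IsFiniteMeasure ν]
    {f g : X → ℝ} (hf : IsContDensity ζ μ f) (hg : IsContDensity ζ ν g) :
    ∫⁻ x, ENNReal.ofReal (f x - g x) ∂ζ ≤ ENNReal.ofReal (tvDist μ ν) := by
  set B : Set X := {x | g x ≤ f x} with hB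
  have mB : MeasurableSet B := measurableSet_le hg.continuous.measurable hf.continuous.measurable
  have h0 : ∫⁻ x, ENNReal.ofReal (f x - g x) ∂ζ = ∫⁻ x in B, ENNReal.ofReal (f x - g x) ∂ζ := by
    rw [← lintegral_indicator mB]
    congr 1
    ext x
    by_cases hx : x ∈ B
    · rw [Set.indicator_of_mem hx]
    · rw [Set.indicator_of_notMem hx, ENNReal.ofReal_eq_zero]
      have : ¬ g x ≤ f x := hx
      linarith
  have h1 : ν B + ∫⁻ x in B, ENNReal.ofReal (f x - g x) ∂ζ ≤ μ B := by
    rw [hf.apply mB, hg.apply mB, ← lintegral_add_left hg.measurable]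
    refine setLIntegral_mono hf.measurable fun y hy => ?_
    have hy : g y ≤ f y := hy
    rw [← ENNReal.ofReal_add (hg.nonneg y) (sub_nonneg.2 hy)]
    simp
  rw [h0]
  refine (ENNReal.le_sub_of_add_le_left (measure_ne_top _ _) h1).trans ?_
  rw [← ofReal_measureReal (μ := μ), ← ofReal_measureReal (μ := ν),
    ← ENNReal.ofReal_sub _ measureReal_nonneg]
  exact ENNReal.ofReal_le_ofReal ((le_abs_self _).trans (abs_real_sub_le_tvDist μ ν mB))

/-- A limit in total variation of measures whose continuous densities belong to an equicontinuous
family has a continuous density. -/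
theorem exists_isContDensity_of_tendsto [ζ.IsOpenPosMeasure] {S : Set (X → ℝ)}
    (hS : S.Equicontinuous) {μ : ℕ → Measure X} {ν : Measure X} [∀ n, IsFiniteMeasure (μ n)]
    [IsFiniteMeasure ν] {g : ℕ → X → ℝ} (hgS : ∀ n, g n ∈ S)
    (hg : ∀ n, IsContDensity ζ (μ n) (g n))
    (hlim : Tendsto (fun n => tvDist (μ n) ν) atTop (𝓝 0)) :
    ∃ f, IsContDensity ζ ν f := by
  have hclose : ∀ δ > 0, ∃ N, ∀ m ≥ N, ∀ n ≥ N, tvDist (μ m) (μ n) < δ := by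
    intro δ hδ
    obtain ⟨N, hN⟩ := eventually_atTop.1 (hlim.eventually_lt_const (half_pos hδ))
    refine ⟨N, fun m hm n hn => (tvDist_triangle _ ν _).trans_lt ?_⟩
    have h1 := hN m hm
    have h2 := hN n hn
    rw [tvDist_comm ν]
    linarith
  have hcauchy : ∀ x, CauchySeq fun n => g n x := by
    intro x
    refine Metric.cauchySeq_iff.2 fun ε hε => ?_
    obtain ⟨U, hU, δ, hδ, h⟩ := exists_nhds_density_close (ζ := ζ) hS x hε
    obtain ⟨N, hN⟩ := hclose δ hδ
    exact ⟨N, fun m hm n hn => h _ _ _ (hgS m) _ (hgS n) (hg m) (hg n) (hN m hm n hn) x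
      (mem_of_mem_nhds hU)⟩
  choose f hf using fun x => cauchySeq_tendsto_of_complete (hcauchy x)
  have hcont : Continuous f := Tendsto.continuous_of_equicontinuous (l := atTop) (F := g)
    (tendsto_pi_nhds.2 hf) (hS.comp fun n => ⟨g n, hgS n⟩)
  have hf0 : ∀ x, 0 ≤ f x := fun x => ge_of_tendsto' (hf x) fun n => (hg n).nonneg x
  -- Fatou's lemma bounds the limit density from above; equality needs that no mass escapes.
  have hle : ∀ A, MeasurableSet A → ∫⁻ x in A, ENNReal.ofReal (f x) ∂ζ ≤ ν A := by
    intro A hA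
    have hlimA : Tendsto (fun n => μ n A) atTop (𝓝 (ν A)) := by
      refine (ENNReal.tendsto_toReal_iff (fun _ => measure_ne_top _ _) (measure_ne_top _ _)).1 ?_
      refine tendsto_iff_dist_tendsto_zero.2 (squeeze_zero (fun _ => dist_nonneg) (fun n => ?_) hlim)
      exact abs_real_sub_le_tvDist _ _ hA
    calc ∫⁻ x in A, ENNReal.ofReal (f x) ∂ζ
        = ∫⁻ x in A, liminf (fun n => ENNReal.ofReal (g n x)) atTop ∂ζ := by
          refine lintegral_congr fun x => ?_
          exact (ENNReal.tendsto_ofReal (hf x)).liminf_eq.symm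
      _ ≤ liminf (fun n => ∫⁻ x in A, ENNReal.ofReal (g n x) ∂ζ) atTop :=
          lintegral_liminf_le fun n => (hg n).measurable
      _ = ν A := by
          simp_rw [← fun n => (hg n).apply hA]
          exact hlimA.liminf_eq
  have mf : Measurable fun x => ENNReal.ofReal (f x) := hcont.measurable.ennreal_ofReal
  have hge : ∀ A, MeasurableSet A → ν A ≤ ∫⁻ x in A, ENNReal.ofReal (f x) ∂ζ := by
    intro A hA
    refine ENNReal.le_of_forall_pos_le_add fun ε hε _ => ?_
    have hε2 : (0 : ℝ) < ε / 2 := by positivity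
    obtain ⟨N, hN⟩ := hclose (ε / 2) hε2
    obtain ⟨n, hn, hnN⟩ := ((hlim.eventually_lt_const hε2).and (eventually_ge_atTop N)).exists
    have h1 : ν A ≤ μ n A + ENNReal.ofReal (ε / 2) := by
      rw [← ofReal_measureReal (μ := ν), ← ofReal_measureReal (μ := μ n),
        ← ENNReal.ofReal_add measureReal_nonneg hε2.le]
      refine ENNReal.ofReal_le_ofReal ?_
      have := abs_le.1 ((abs_real_sub_le_tvDist (μ n) ν hA).trans hn.le)
      linarith
    -- Fatou in `m`: the positive part of g_n - f is the limit of those of g_n - g_m, whose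
    -- integrals are bounded by total variation distances in the Cauchy tail.
    have h2 : ∫⁻ x, ENNReal.ofReal (g n x - f x) ∂ζ ≤ ENNReal.ofReal (ε / 2) := by
      calc ∫⁻ x, ENNReal.ofReal (g n x - f x) ∂ζ
          = ∫⁻ x, liminf (fun m => ENNReal.ofReal (g n x - g m x)) atTop ∂ζ := by
            refine lintegral_congr fun x => ?_
            exact (ENNReal.tendsto_ofReal ((hf x).const_sub (g n x))).liminf_eq.symm
        _ ≤ liminf (fun m => ∫⁻ x, ENNReal.ofReal (g n x - g m x) ∂ζ) atTop :=
            lintegral_liminf_le fun m =>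
              ((hg n).continuous.sub (hg m).continuous).measurable.ennreal_ofReal
        _ ≤ ENNReal.ofReal (ε / 2) := by
            refine liminf_le_of_frequently_le' (Eventually.frequently ?_)
            filter_upwards [eventually_ge_atTop N] with m hm
            exact (lintegral_ofReal_sub_le_tvDist (hg n) (hg m)).trans
              (ENNReal.ofReal_le_ofReal (hN n hnN m hm).le)
    have h3 : μ n A ≤ (∫⁻ x in A, ENNReal.ofReal (f x) ∂ζ) + ENNReal.ofReal (ε / 2) := by
      calc μ n A = ∫⁻ x in A, ENNReal.ofReal (g n x) ∂ζ := (hg n).apply hA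
        _ ≤ ∫⁻ x in A, (ENNReal.ofReal (f x) + ENNReal.ofReal (g n x - f x)) ∂ζ := by
            refine lintegral_mono fun x => ?_
            refine le_trans (ENNReal.ofReal_le_ofReal ?_) ENNReal.ofReal_add_le
            simp
        _ = (∫⁻ x in A, ENNReal.ofReal (f x) ∂ζ) + ∫⁻ x in A, ENNReal.ofReal (g n x - f x) ∂ζ :=
            lintegral_add_left mf _
        _ ≤ _ := by
            gcongr
            exact (setLIntegral_le_lintegral _ _).trans h2
    calc ν A ≤ μ n A + ENNReal.ofReal (ε / 2) := h1
      _ ≤ (∫⁻ x in A, ENNReal.ofReal (f x) ∂ζ) + ENNReal.ofReal (ε / 2)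
          + ENNReal.ofReal (ε / 2) := by gcongr
      _ = (∫⁻ x in A, ENNReal.ofReal (f x) ∂ζ) + ε := by
          rw [add_assoc, ← ENNReal.ofReal_add hε2.le hε2.le, add_halves, ENNReal.ofReal_coe_nnreal]
  refine ⟨f, hcont, hf0, ?_⟩
  ext A hA
  rw [withDensity_apply _ hA]
  exact (hge A hA).antisymm (hle A hA)

end Density

/-! ### Equicontinuity of enlarged families -/

theorem equicontinuous_convexHull {Y : Type*} [TopologicalSpace Y] {S : Set (Y → ℝ)}
    (hS : S.Equicontinuous) : (convexHull ℝ S).Equicontinuous := by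
  intro x
  refine Metric.equicontinuousAt_iff_right.2 fun ε hε => ?_
  filter_upwards [Metric.equicontinuousAt_iff_right.1 (hS x) ε hε] with y hy
  -- For fixed `x` and `y`, the condition |f x - f y| < ε is convex in f, so a neighbourhood that
  -- serves `S` serves its hull.
  have hconv : Convex ℝ {f : Y → ℝ | f x - f y ∈ Metric.ball (0 : ℝ) ε} :=
    (convex_ball (0 : ℝ) ε).is_linear_preimage
      (f := fun f : Y → ℝ => f x - f y)
      ⟨fun f g => by simp; ring, fun c f => by simp [mul_sub]⟩
  rintro ⟨f, hf⟩
  have := convexHull_min (fun g hg => by simpa [Real.dist_eq] using hy ⟨g, hg⟩) hconv hf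
  simpa [Real.dist_eq] using this

/-- Needed because the density of γ_k is only a limit of elements of the hull, while the comparison
requires both densities in one equicontinuous family. -/
theorem equicontinuous_insert {Y : Type*} [TopologicalSpace Y] {S : Set (Y → ℝ)}
    (hS : S.Equicontinuous) {f : Y → ℝ} (hf : Continuous f) : (insert f S).Equicontinuous := by
  intro x
  refine Metric.equicontinuousAt_iff_right.2 fun ε hε => ?_
  filter_upwards [Metric.equicontinuousAt_iff_right.1 (hS x) ε hε,
    Metric.continuousAt_iff'.1 hf.continuousAt ε hε] with y hy hfy
  rintro ⟨g, rfl | hg⟩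
  · rw [dist_comm]
    exact hfy
  · exact hy ⟨g, hg⟩

/-! ### Wasserstein-close mixing measures -/

namespace MixingMeasure

theorem weight_pos {Ω : MixingMeasure X} {q : ProbabilityMeasure X} (hq : q ∈ Ω.atoms) :
    0 < Ω.weight q :=
  pos_iff_ne_zero.2 (Finsupp.mem_support_iff.1 hq)

theorem sum_weight_real (Ω : MixingMeasure X) : ∑ q ∈ Ω.atoms, (Ω.weight q : ℝ) = 1 := by
  exact_mod_cast Ω.sum_weight

end MixingMeasure

/-- A strict lower bound for finitely many numbers leaves room for a larger one, including when no
index satisfies `P`. -/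
theorem eventually_nhdsGT_forall_le {ι : Type*} (s : Finset ι) (P : ι → Prop) (f : ι → ℝ) {a : ℝ}
    (h : ∀ i ∈ s, P i → a < f i) : ∀ᶠ b in 𝓝[>] a, ∀ i ∈ s, P i → b ≤ f i := by
  refine (Finset.eventually_all s).2 fun i hi => ?_
  by_cases hP : P i
  · filter_upwards [Ioo_mem_nhdsGT (h i hi hP)] with b hb _
    exact hb.2.le
  · exact Eventually.of_forall fun _ h => absurd h hP

theorem exists_coupling_of_wasserstein_lt {r : ℝ} {Ω Ω' : MixingMeasure X} {δ : ℝ}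
    (h : wasserstein r Ω Ω' < δ) : ∃ σ : ProbabilityMeasure X → ProbabilityMeasure X → ℝ,
      (∀ p q, 0 ≤ σ p q) ∧
      (∀ p ∈ Ω.atoms, ∑ q ∈ Ω'.atoms, σ p q = Ω.weight p) ∧
      (∀ q ∈ Ω'.atoms, ∑ p ∈ Ω.atoms, σ p q = Ω'.weight q) ∧
      (∑ p ∈ Ω.atoms, ∑ q ∈ Ω'.atoms, σ p q * hellinger (p : Measure X) q ^ r) ^ (1 / r) < δ := by
  unfold wasserstein at h
  obtain ⟨c, ⟨σ, h0, h1, h2, rfl⟩, hc⟩ := exists_lt_of_csInf_lt (by exact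
    -- The product coupling shows that the infimum is over a nonempty set.
    ⟨_, fun p q => (Ω.weight p : ℝ) * Ω'.weight q, fun p q => by positivity,
      fun p _ => by rw [← Finset.mul_sum, Ω'.sum_weight_real, mul_one],
      fun q _ => by rw [← Finset.sum_mul, Ω.sum_weight_real, one_mul], rfl⟩) h
  exact ⟨σ, h0, h1, h2, hc⟩

open Classical in
/-- A mixing measure that is Wasserstein-close to `Ω` and has the same number of atoms has its atoms
in bijection with those of `Ω`, with corresponding atoms and weights close to each other. -/
theorem exists_matching {r : ℝ} (hr : 1 ≤ r) (Ω : MixingMeasure X) {ε : ℝ} (hε : 0 < ε) :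
    ∃ δ > 0, ∀ Ω' : MixingMeasure X, Ω'.atoms.card = Ω.atoms.card → wasserstein r Ω' Ω < δ →
      ∃ φ : ProbabilityMeasure X → ProbabilityMeasure X, Set.InjOn φ Ω.atoms ∧
        Ω.atoms.image φ = Ω'.atoms ∧ ∀ q ∈ Ω.atoms, hellinger (φ q : Measure X) q < ε ∧
          |(Ω'.weight (φ q) : ℝ) - Ω.weight q| < ε := by
  have hr0 : 0 < r := by linarith
  obtain ⟨s, hs, hs0⟩ := ((eventually_nhdsGT_forall_le (a := 0) (Ω.atoms ×ˢ Ω.atoms)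
    (fun i => i.1 ≠ i.2) (fun i => hellinger (i.1 : Measure X) i.2)
    fun i _ hne => hellinger_pos hne).and self_mem_nhdsWithin).exists
  obtain ⟨w, hw, hw0⟩ := ((eventually_nhdsGT_forall_le (a := 0) Ω.atoms
    (fun _ => True) (fun q => (Ω.weight q : ℝ))
    fun q hq _ => by exact_mod_cast MixingMeasure.weight_pos hq).and self_mem_nhdsWithin).exists
  have hs0 : 0 < s := hs0
  have hw0 : 0 < w := hw0
  -- `s` bounds the distances between atoms of `Ω` from below and `w` their weights. Since e ≤ s/2,
  -- a point within `e` of one atom is at least `e` from the others.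
  set e := min ε (s / 2) with he_def
  have he : 0 < e := lt_min hε (half_pos hs0)
  set m := min w ε with hm_def
  have hm : 0 < m := lt_min hw0 hε
  have her : 0 < e ^ r := Real.rpow_pos_of_pos he r
  refine ⟨(m * e ^ r) ^ (1 / r), Real.rpow_pos_of_pos (mul_pos hm her) _, fun Ω' hcard hW => ?_⟩
  obtain ⟨σ, σ0, σ1, σ2, hσ⟩ := exists_coupling_of_wasserstein_lt hW
  have hterm : ∀ p q : ProbabilityMeasure X, 0 ≤ σ p q * hellinger (p : Measure X) q ^ r :=
    fun p q => mul_nonneg (σ0 p q) (Real.rpow_nonneg (hellinger_nonneg _ _) r)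
  have hT : ∑ p ∈ Ω'.atoms, ∑ q ∈ Ω.atoms, σ p q * hellinger (p : Measure X) q ^ r < m * e ^ r :=
    (Real.rpow_lt_rpow_iff (Finset.sum_nonneg fun p _ => Finset.sum_nonneg fun q _ => hterm p q)
      (mul_pos hm her).le (by positivity)).1 hσ
  -- Markov's inequality for the transport cost: mass moved by `e` or more totals less than `m`.
  have key : ∀ A ⊆ Ω'.atoms, ∀ B ⊆ Ω.atoms,
      (∀ p ∈ A, ∀ q ∈ B, e ≤ hellinger (p : Measure X) q) → ∑ p ∈ A, ∑ q ∈ B, σ p q < m := by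
    intro A hA B hB hAB
    refine lt_of_mul_lt_mul_right ?_ her.le
    refine lt_of_le_of_lt ?_ hT
    calc (∑ p ∈ A, ∑ q ∈ B, σ p q) * e ^ r = ∑ p ∈ A, ∑ q ∈ B, σ p q * e ^ r := by
          simp_rw [Finset.sum_mul]
      _ ≤ ∑ p ∈ A, ∑ q ∈ B, σ p q * hellinger (p : Measure X) q ^ r :=
          Finset.sum_le_sum fun p hp => Finset.sum_le_sum fun q hq =>
            mul_le_mul_of_nonneg_left (Real.rpow_le_rpow he.le (hAB p hp q hq) hr0.le) (σ0 p q)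
      _ ≤ ∑ p ∈ A, ∑ q ∈ Ω.atoms, σ p q * hellinger (p : Measure X) q ^ r :=
          Finset.sum_le_sum fun p _ =>
            Finset.sum_le_sum_of_subset_of_nonneg hB fun q _ _ => hterm p q
      _ ≤ _ := Finset.sum_le_sum_of_subset_of_nonneg hA fun p _ _ =>
          Finset.sum_nonneg fun q _ => hterm p q
  -- If no atom of `Ω'` were within `e` of `q`, the whole weight of `q`, at least w ≥ m, would
  -- travel that far.
  have hnear : ∀ q : ProbabilityMeasure X, ∃ p : ProbabilityMeasure X,
      q ∈ Ω.atoms → p ∈ Ω'.atoms ∧ hellinger (p : Measure X) q < e := by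
    intro q
    by_contra! hcon
    have hq : q ∈ Ω.atoms := (hcon q).1
    have := key Ω'.atoms subset_rfl {q} (Finset.singleton_subset_iff.2 hq) fun p hp q' hq' => by
      rw [Finset.mem_singleton.1 hq']
      exact (hcon p).2 hp
    simp only [Finset.sum_singleton, σ2 q hq] at this
    exact absurd (this.trans_le (min_le_left _ _)) (not_lt.2 (hw q hq trivial))
  choose φ hφ using hnear
  have htri : ∀ q q' : ProbabilityMeasure X, q ∈ Ω.atoms → q' ∈ Ω.atoms → q' ≠ q →
      e ≤ hellinger (φ q' : Measure X) q := by
    intro q q' hq hq' hne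
    have h1 : s ≤ hellinger (q' : Measure X) q :=
      hs (q', q) (Finset.mem_product.2 ⟨hq', hq⟩) hne
    have h2 := hellinger_triangle (q' : Measure X) (φ q') q
    have h3 := (hφ q' hq').2
    rw [hellinger_comm] at h3
    have h4 : e ≤ s / 2 := min_le_right _ _
    linarith
  have hinj : Set.InjOn φ Ω.atoms := by
    intro q hq q' hq' h
    by_contra hne
    have h1 := htri q' q hq' hq hne
    rw [h] at h1
    exact absurd (hφ q' hq').2 (not_lt.2 h1)
  have himage : Ω.atoms.image φ = Ω'.atoms := by
    refine Finset.eq_of_subset_of_card_le ?_ ?_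
    · intro p hp
      obtain ⟨q, hq, rfl⟩ := Finset.mem_image.1 hp
      exact (hφ q hq).1
    · rw [Finset.card_image_of_injOn hinj, hcard]
  refine ⟨φ, hinj, himage, fun q hq => ⟨(hφ q hq).2.trans_le (min_le_left _ _), ?_⟩⟩
  -- Both weights contain the entry σ(φ q, q); what remains of each travels at least `e`, hence is
  -- less than m ≤ ε.
  have hD1 := key (Ω'.atoms.erase (φ q)) (Finset.erase_subset _ _) {q}
    (Finset.singleton_subset_iff.2 hq) fun p hp q' hq' => by
      rw [Finset.mem_singleton.1 hq']
      obtain ⟨hne, hp⟩ := Finset.mem_erase.1 hp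
      rw [← himage] at hp
      obtain ⟨q'', hq'', rfl⟩ := Finset.mem_image.1 hp
      exact htri q q'' hq hq'' fun h => hne (by rw [h])
  have hD2 := key {φ q} (Finset.singleton_subset_iff.2 (hφ q hq).1) (Ω.atoms.erase q)
    (Finset.erase_subset _ _) fun p hp q' hq' => by
      rw [Finset.mem_singleton.1 hp]
      obtain ⟨hne, hq'⟩ := Finset.mem_erase.1 hq'
      exact htri q' q hq' hq hne.symm
  simp only [Finset.sum_singleton] at hD1 hD2
  have h1 := σ2 q hq
  have h2 := σ1 (φ q) (hφ q hq).1
  rw [← Finset.add_sum_erase _ _ (hφ q hq).1] at h1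
  rw [← Finset.add_sum_erase _ _ hq] at h2
  have h3 : 0 ≤ ∑ p ∈ Ω'.atoms.erase (φ q), σ p q := Finset.sum_nonneg fun p _ => σ0 p q
  have h4 : 0 ≤ ∑ q' ∈ Ω.atoms.erase q, σ (φ q) q' := Finset.sum_nonneg fun q' _ => σ0 _ q'
  have h5 : m ≤ ε := min_le_right _ _
  exact abs_lt.2 ⟨by linarith, by linarith⟩

/-! ### Clusters -/

section Clusters

variable {K : ℕ}

theorem mem_clusterAtoms {Ω : MixingMeasure X} {α : ProbabilityMeasure X → Fin K} {k : Fin K}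
    {q : ProbabilityMeasure X} : q ∈ clusterAtoms Ω α k ↔ q ∈ Ω.atoms ∧ α q = k :=
  Finset.mem_filter

theorem clusterWeight_pos {Ω : MixingMeasure X} {α : ProbabilityMeasure X → Fin K} {k : Fin K} :
    0 < clusterWeight Ω α k ↔ ∃ q ∈ Ω.atoms, α q = k := by
  constructor
  · intro h
    by_contra! hcon
    have : clusterAtoms Ω α k = ∅ := Finset.filter_eq_empty_iff.2 fun q hq => hcon q hq
    simp [clusterWeight, this] at h
  · rintro ⟨q, hq, hk⟩
    exact Finset.sum_pos (fun p hp => MixingMeasure.weight_pos (mem_clusterAtoms.1 hp).1)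
      ⟨q, mem_clusterAtoms.2 ⟨hq, hk⟩⟩

theorem clusterMeasure_apply (Ω : MixingMeasure X) (α : ProbabilityMeasure X → Fin K) (k : Fin K)
    (A : Set X) : clusterMeasure Ω α k A = (clusterWeight Ω α k)⁻¹ *
      ∑ q ∈ clusterAtoms Ω α k, Ω.weight q * (q : Measure X) A := by
  simp only [clusterMeasure, Measure.smul_apply, Measure.finsetSum_apply, ENNReal.smul_def,
    smul_eq_mul]

theorem clusterMeasure_real (Ω : MixingMeasure X) (α : ProbabilityMeasure X → Fin K) (k : Fin K)
    (A : Set X) : (clusterMeasure Ω α k).real A = (clusterWeight Ω α k : ℝ)⁻¹ *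
      ∑ q ∈ clusterAtoms Ω α k, Ω.weight q * (q : Measure X).real A := by
  rw [measureReal_def, clusterMeasure_apply, ENNReal.toReal_mul, ENNReal.toReal_sum
    fun q _ => ENNReal.mul_ne_top ENNReal.coe_ne_top (measure_ne_top _ _)]
  simp [ENNReal.toReal_mul, measureReal_def]

instance isFiniteMeasure_clusterMeasure (Ω : MixingMeasure X) (α : ProbabilityMeasure X → Fin K)
    (k : Fin K) : IsFiniteMeasure (clusterMeasure Ω α k) := by
  unfold clusterMeasure
  infer_instance

theorem isProbabilityMeasure_clusterMeasure {Ω : MixingMeasure X}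
    {α : ProbabilityMeasure X → Fin K} {k : Fin K} (h : 0 < clusterWeight Ω α k) :
    IsProbabilityMeasure (clusterMeasure Ω α k) := by
  refine ⟨?_⟩
  rw [clusterMeasure_apply]
  simp only [measure_univ, mul_one]
  rw [← ENNReal.ofNNReal_finsetSum, ← ENNReal.coe_mul]
  exact_mod_cast inv_mul_cancel₀ h.ne'

theorem clusterMeasure_real_univ_le_one (Ω : MixingMeasure X) (α : ProbabilityMeasure X → Fin K)
    (k : Fin K) : (clusterMeasure Ω α k).real Set.univ ≤ 1 := by
  rw [clusterMeasure_real]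
  simp only [probReal_univ, mul_one]
  rw [← NNReal.coe_sum]
  exact inv_mul_le_one

/-- Measures have only ℝ≥0 scalars, so induct: the new point is combined with the normalized rest. A
rest of weight zero cannot be normalized and is treated apart. -/
theorem sum_smul_mem_of_convex {E ι : Type*} [AddCommMonoid E] [Module ℝ≥0 E] {C : Set E}
    (hC : Convex ℝ≥0 C) (s : Finset ι) (w : ι → ℝ≥0) (z : ι → E) (hz : ∀ i ∈ s, z i ∈ C)
    (hw : 0 < ∑ i ∈ s, w i) : (∑ i ∈ s, w i)⁻¹ • ∑ i ∈ s, w i • z i ∈ C := by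
  classical
  induction s using Finset.induction_on with
  | empty => simp at hw
  | insert a s ha ih =>
    rw [Finset.sum_insert ha] at hw
    rw [Finset.sum_insert ha, Finset.sum_insert ha]
    have hza := hz a (Finset.mem_insert_self a s)
    rcases (zero_le (a := ∑ i ∈ s, w i)).eq_or_lt with h0 | h0
    · have h1 : ∀ i ∈ s, w i = 0 := (Finset.sum_eq_zero_iff).1 h0.symm
      have h2 : ∑ i ∈ s, w i • z i = 0 :=
        Finset.sum_eq_zero fun i hi => by rw [h1 i hi, zero_smul]
      rw [h2, ← h0, add_zero, add_zero,
        smul_smul, inv_mul_cancel₀ (by simpa [← h0] using hw.ne'), one_smul]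
      exact hza
    · have h2 := hC hza (ih (fun i hi => hz i (Finset.mem_insert_of_mem hi)) h0)
        (a := (w a + ∑ i ∈ s, w i)⁻¹ * w a) (b := (w a + ∑ i ∈ s, w i)⁻¹ * ∑ i ∈ s, w i)
        zero_le zero_le (by rw [← mul_add, inv_mul_cancel₀ hw.ne'])
      rwa [smul_smul, mul_assoc, mul_inv_cancel₀ h0.ne', mul_one, mul_smul, ← smul_add] at h2

theorem clusterMeasure_mem_convexHull {Ω : MixingMeasure X} {α : ProbabilityMeasure X → Fin K}
    {k : Fin K} (h : 0 < clusterWeight Ω α k) :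
    clusterMeasure Ω α k ∈ convexHull ℝ≥0
      ((fun q : ProbabilityMeasure X => (q : Measure X)) '' clusterAtoms Ω α k) :=
  sum_smul_mem_of_convex (convex_convexHull _ _) _ _ _
    (fun q hq => subset_convexHull _ _ ⟨q, hq, rfl⟩) h

theorem measure_univ_of_mem_convexHull {S : Finset (ProbabilityMeasure X)} {μ : Measure X}
    (h : μ ∈ convexHull ℝ≥0 ((fun q : ProbabilityMeasure X => (q : Measure X)) '' S)) :
    μ Set.univ = 1 := by
  have hc : Convex ℝ≥0 {μ : Measure X | μ Set.univ = 1} := by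
    intro μ hμ ν hν a b _ _ hab
    have hμ : μ Set.univ = 1 := hμ
    have hν : ν Set.univ = 1 := hν
    have : (a : ℝ≥0∞) + b = 1 := by exact_mod_cast hab
    simpa only [Set.mem_ofPred_eq, Measure.add_apply, Measure.smul_apply, ENNReal.smul_def, hμ, hν,
      smul_eq_mul, mul_one] using this
  refine convexHull_min ?_ hc h
  rintro _ ⟨q, -, rfl⟩
  exact measure_univ (μ := (q : Measure X))

theorem hellinger_le_one_of_univ {μ ν : Measure X} (hμ : μ Set.univ = 1) (hν : ν Set.univ = 1) :
    hellinger μ ν ≤ 1 := by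
  have : IsProbabilityMeasure μ := ⟨hμ⟩
  have : IsProbabilityMeasure ν := ⟨hν⟩
  exact hellinger_le_one probReal_univ.le probReal_univ.le

theorem hellinger_le_hellingerDiam {S : Finset (ProbabilityMeasure X)} {μ ν : Measure X}
    (hμ : μ ∈ convexHull ℝ≥0 ((fun q : ProbabilityMeasure X => (q : Measure X)) '' S))
    (hν : ν ∈ convexHull ℝ≥0 ((fun q : ProbabilityMeasure X => (q : Measure X)) '' S)) :
    hellinger μ ν ≤ hellingerDiam S := by
  refine le_csSup ⟨1, ?_⟩ ⟨μ, hμ, ν, hν, rfl⟩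
  rintro _ ⟨P, hP, P', hP', rfl⟩
  exact hellinger_le_one_of_univ (measure_univ_of_mem_convexHull hP)
    (measure_univ_of_mem_convexHull hP')

theorem hellingerDiam_nonneg (S : Finset (ProbabilityMeasure X)) : 0 ≤ hellingerDiam S := by
  refine Real.sSup_nonneg ?_
  rintro _ ⟨P, -, P', -, rfl⟩
  exact hellinger_nonneg _ _

theorem hellingerDiam_le_one (S : Finset (ProbabilityMeasure X)) : hellingerDiam S ≤ 1 := by
  refine Real.sSup_le ?_ zero_le_one
  rintro _ ⟨P, hP, P', hP', rfl⟩
  exact hellinger_le_one_of_univ (measure_univ_of_mem_convexHull hP)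
    (measure_univ_of_mem_convexHull hP')

theorem add_le_eta (γ : Fin K → ProbabilityMeasure X) (Ω : MixingMeasure X)
    (α : ProbabilityMeasure X → Fin K) (k : Fin K) :
    hellingerDiam (clusterAtoms Ω α k) + hellinger (γ k : Measure X) (clusterMeasure Ω α k) ≤
      eta γ Ω α :=
  add_le_add (le_ciSup (f := fun k => hellingerDiam (clusterAtoms Ω α k))
      (Set.finite_range _).bddAbove k)
    (le_ciSup (f := fun k => hellinger (γ k : Measure X) (clusterMeasure Ω α k))
      (Set.finite_range _).bddAbove k)

theorem eta_nonneg (γ : Fin K → ProbabilityMeasure X) (Ω : MixingMeasure X)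
    (α : ProbabilityMeasure X → Fin K) : 0 ≤ eta γ Ω α :=
  add_nonneg (Real.iSup_nonneg fun _ => hellingerDiam_nonneg _)
    (Real.iSup_nonneg fun _ => hellinger_nonneg _ _)

/-- Boundedness is what lets the real-valued limsup of η control the sequence. -/
theorem eta_le_two (γ : Fin K → ProbabilityMeasure X) (Ω : MixingMeasure X)
    (α : ProbabilityMeasure X → Fin K) : eta γ Ω α ≤ 2 := by
  rw [← one_add_one_eq_two]
  exact add_le_add (Real.iSup_le (fun _ => hellingerDiam_le_one _) zero_le_one)
    (Real.iSup_le (fun k => hellinger_le_one probReal_univ.le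
      (clusterMeasure_real_univ_le_one Ω α k)) zero_le_one)

theorem hellinger_le_eta_of_same_cluster (γ : Fin K → ProbabilityMeasure X) {Ω : MixingMeasure X}
    {α : ProbabilityMeasure X → Fin K} {p q : ProbabilityMeasure X} (hp : p ∈ Ω.atoms)
    (hq : q ∈ Ω.atoms) (h : α p = α q) : hellinger (p : Measure X) q ≤ eta γ Ω α := by
  have h1 : hellinger (p : Measure X) q ≤ hellingerDiam (clusterAtoms Ω α (α q)) :=
    hellinger_le_hellingerDiam
      (subset_convexHull _ _ ⟨p, mem_clusterAtoms.2 ⟨hp, h⟩, rfl⟩)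
      (subset_convexHull _ _ ⟨q, mem_clusterAtoms.2 ⟨hq, rfl⟩, rfl⟩)
  have h2 := add_le_eta γ Ω α (α q)
  have h3 := hellinger_nonneg (γ (α q) : Measure X) (clusterMeasure Ω α (α q))
  linarith

theorem hellinger_component_le_eta (γ : Fin K → ProbabilityMeasure X) {Ω : MixingMeasure X}
    {α : ProbabilityMeasure X → Fin K} {q : ProbabilityMeasure X} (hq : q ∈ Ω.atoms) :
    hellinger (γ (α q) : Measure X) q ≤ eta γ Ω α := by
  have h1 : hellinger (clusterMeasure Ω α (α q)) q ≤ hellingerDiam (clusterAtoms Ω α (α q)) :=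
    hellinger_le_hellingerDiam (clusterMeasure_mem_convexHull (clusterWeight_pos.2 ⟨q, hq, rfl⟩))
      (subset_convexHull _ _ ⟨q, mem_clusterAtoms.2 ⟨hq, rfl⟩, rfl⟩)
  have h2 := add_le_eta γ Ω α (α q)
  have h3 := hellinger_triangle (γ (α q) : Measure X) (clusterMeasure Ω α (α q)) q
  linarith

/-- Each atom is within η of its own γ, so the distance exceeds 4η - 2η, which is at least η. -/
theorem lt_hellinger_of_different_cluster {γ : Fin K → ProbabilityMeasure X} {Ω : MixingMeasure X}
    {α : ProbabilityMeasure X → Fin K}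
    (hsep : ∀ i j, i ≠ j → 4 * eta γ Ω α < hellinger (γ i : Measure X) (γ j))
    {p q : ProbabilityMeasure X} (hp : p ∈ Ω.atoms) (hq : q ∈ Ω.atoms) (h : α p ≠ α q) :
    eta γ Ω α < hellinger (p : Measure X) q := by
  have h1 := hsep _ _ h
  have h2 := hellinger_component_le_eta γ (α := α) hp
  have h3 := hellinger_component_le_eta γ (α := α) hq
  have h4 := hellinger_triangle (γ (α p) : Measure X) p (γ (α q))
  have h5 := hellinger_triangle (p : Measure X) q (γ (α q))
  rw [hellinger_comm] at h3
  have h6 := eta_nonneg γ Ω α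
  linarith

/-! ### Single-linkage clustering -/

/-- At level `t` one link joins any two atoms of a cluster, and no link leaves a cluster. -/
theorem isSingleLinkage_of_gap {Ω : MixingMeasure X} {β : ProbabilityMeasure X → Fin K} {t : ℝ}
    (hsurj : ∀ k, ∃ q ∈ Ω.atoms, β q = k)
    (hle : ∀ p ∈ Ω.atoms, ∀ q ∈ Ω.atoms, β p = β q → hellinger (p : Measure X) q ≤ t)
    (hlt : ∀ p ∈ Ω.atoms, ∀ q ∈ Ω.atoms, β p ≠ β q → t < hellinger (p : Measure X) q) :
    IsSingleLinkage Ω β := by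
  refine ⟨hsurj, t, fun p hp q hq => ⟨fun h => ?_, fun h => ?_⟩⟩
  · exact Relation.ReflTransGen.single ⟨hp, hq, hle p hp q hq h⟩
  · clear hq
    induction h with
    | refl => rfl
    | tail _ hbc ih =>
      refine ih.trans ?_
      by_contra hne
      exact absurd hbc.2.2 (not_le.2 (hlt _ hbc.1 _ hbc.2.1 hne))

theorem Linked.mono {S : Finset (ProbabilityMeasure X)} {t t' : ℝ} (h : t ≤ t')
    {p q : ProbabilityMeasure X} (hpq : Linked S t p q) : Linked S t' p q :=
  Relation.ReflTransGen.mono (fun _ _ h' => ⟨h'.1, h'.2.1, h'.2.2.trans h⟩) _ _ hpq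

/-- A refinement induces a surjection between block labels; both partitions have `K` nonempty
blocks, so it is a bijection. -/
theorem exists_perm_of_refines {S : Finset (ProbabilityMeasure X)}
    {β β' : ProbabilityMeasure X → Fin K} (hβ : ∀ k, ∃ q ∈ S, β q = k)
    (hβ' : ∀ k, ∃ q ∈ S, β' q = k) (h : ∀ p ∈ S, ∀ q ∈ S, β p = β q → β' p = β' q) :
    ∃ τ : Equiv.Perm (Fin K), ∀ p ∈ S, β' p = τ (β p) := by
  choose s hsS hs using hβ
  have hg : ∀ p ∈ S, β' p = β' (s (β p)) := fun p hp => h p hp _ (hsS _) (hs _).symm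
  have hsurj : Function.Surjective fun k => β' (s k) := by
    intro k
    obtain ⟨q, hq, hk⟩ := hβ' k
    exact ⟨β q, (hg q hq).symm.trans hk⟩
  exact ⟨Equiv.ofBijective _ (Finite.surjective_iff_bijective.1 hsurj), hg⟩

/-- A single-linkage clustering into `K` clusters is unique up to the labels of the clusters. -/
theorem IsSingleLinkage.exists_perm {Ω : MixingMeasure X} {β β' : ProbabilityMeasure X → Fin K}
    (h : IsSingleLinkage Ω β) (h' : IsSingleLinkage Ω β') :
    ∃ τ : Equiv.Perm (Fin K), ∀ p ∈ Ω.atoms, β' p = τ (β p) := by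
  obtain ⟨hs, t, ht⟩ := h
  obtain ⟨hs', t', ht'⟩ := h'
  -- Raising the cutting level coarsens the partition, so one clustering refines the other.
  rcases le_total t t' with hle | hle
  · exact exists_perm_of_refines hs hs' fun p hp q hq hpq =>
      (ht' p hp q hq).2 (((ht p hp q hq).1 hpq).mono hle)
  · obtain ⟨τ, hτ⟩ := exists_perm_of_refines hs' hs fun p hp q hq hpq =>
      (ht p hp q hq).2 (((ht' p hp q hq).1 hpq).mono hle)
    exact ⟨τ.symm, fun p hp => by rw [hτ p hp, Equiv.symm_apply_apply]⟩

/-! ### Stability of the clusters -/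

/-- As N'/D' ≤ 1, only the fixed denominator `D` enters the bound. -/
theorem abs_ratio_sub_le {N D N' D' a b : ℝ} (hD : 0 < D) (hD' : 0 < D') (hN0 : 0 ≤ N')
    (hN : N' ≤ D') (ha : |N' - N| ≤ a) (hb : |D' - D| ≤ b) :
    |D'⁻¹ * N' - D⁻¹ * N| ≤ (a + b) / D := by
  have h1 : D'⁻¹ * N' - D⁻¹ * N = ((N' - N) + N' / D' * (D - D')) / D := by
    field_simp
    ring
  rw [h1, abs_div, abs_of_pos hD]
  refine div_le_div_of_nonneg_right ((abs_add_le _ _).trans (add_le_add ha ?_)) hD.le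
  rw [abs_mul, abs_of_nonneg (div_nonneg hN0 hD'.le), abs_sub_comm]
  exact (mul_le_of_le_one_left (abs_nonneg _) ((div_le_one hD').2 hN)).trans hb

open Classical in
-- Weight errors contribute card · e to both numerator and denominator; atom errors contribute 4e
-- times the cluster weight to the numerator. Dividing by the cluster weight gives the constant.
theorem tvDist_clusterMeasure_le {Ω Ω' : MixingMeasure X} {α β : ProbabilityMeasure X → Fin K}
    {k l : Fin K} {φ : ProbabilityMeasure X → ProbabilityMeasure X} {e : ℝ}
    (hpos : 0 < clusterWeight Ω α k) (hpos' : 0 < clusterWeight Ω' β l)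
    (hinj : Set.InjOn φ (clusterAtoms Ω α k))
    (himage : (clusterAtoms Ω α k).image φ = clusterAtoms Ω' β l)
    (hclose : ∀ q ∈ clusterAtoms Ω α k, hellinger (φ q : Measure X) q < e ∧
      |(Ω'.weight (φ q) : ℝ) - Ω.weight q| < e) :
    tvDist (clusterMeasure Ω' β l) (clusterMeasure Ω α k) ≤
      (2 * (clusterAtoms Ω α k).card / clusterWeight Ω α k + 4) * e := by
  set s := clusterAtoms Ω α k with hs
  have hD : (0 : ℝ) < clusterWeight Ω α k := by exact_mod_cast hpos
  have hD' : (0 : ℝ) < clusterWeight Ω' β l := by exact_mod_cast hpos'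
  have eD : (clusterWeight Ω α k : ℝ) = ∑ q ∈ s, (Ω.weight q : ℝ) := NNReal.coe_sum _ _
  have eD' : (clusterWeight Ω' β l : ℝ) = ∑ q ∈ s, (Ω'.weight (φ q) : ℝ) := by
    rw [clusterWeight, ← himage, Finset.sum_image hinj, NNReal.coe_sum]
  refine tvDist_le fun A hA => ?_
  rw [clusterMeasure_real, clusterMeasure_real, ← himage, Finset.sum_image hinj]
  have ha : |∑ q ∈ s, (Ω'.weight (φ q) : ℝ) * (φ q : Measure X).real A -
      ∑ q ∈ s, (Ω.weight q : ℝ) * (q : Measure X).real A| ≤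
        s.card * e + clusterWeight Ω α k * (4 * e) := by
    rw [← Finset.sum_sub_distrib, eD, Finset.sum_mul, ← nsmul_eq_mul, ← Finset.sum_const,
      ← Finset.sum_add_distrib]
    refine (Finset.abs_sum_le_sum_abs _ _).trans (Finset.sum_le_sum fun q hq => ?_)
    have h1 : (Ω'.weight (φ q) : ℝ) * (φ q : Measure X).real A -
        (Ω.weight q : ℝ) * (q : Measure X).real A =
        ((Ω'.weight (φ q) : ℝ) - Ω.weight q) * (φ q : Measure X).real A +
          Ω.weight q * ((φ q : Measure X).real A - (q : Measure X).real A) := by ring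
    rw [h1]
    refine (abs_add_le _ _).trans (add_le_add ?_ ?_)
    · rw [abs_mul, abs_of_nonneg measureReal_nonneg]
      exact (mul_le_of_le_one_right (abs_nonneg _) measureReal_le_one).trans (hclose q hq).2.le
    · rw [abs_mul, NNReal.abs_eq]
      refine mul_le_mul_of_nonneg_left ?_ NNReal.zero_le_coe
      have h2 := abs_real_sub_le_tvDist (φ q : Measure X) q hA
      have h3 := tvDist_le_hellinger (φ q : Measure X) q
      have h4 := (hclose q hq).1
      linarith
  have hb : |(clusterWeight Ω' β l : ℝ) - clusterWeight Ω α k| ≤ s.card * e := by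
    rw [eD, eD', ← Finset.sum_sub_distrib, ← nsmul_eq_mul, ← Finset.sum_const]
    exact (Finset.abs_sum_le_sum_abs _ _).trans
      (Finset.sum_le_sum fun q hq => (hclose q hq).2.le)
  refine (abs_ratio_sub_le hD hD' ?_ ?_ ha hb).trans_eq ?_
  · exact Finset.sum_nonneg fun q _ => mul_nonneg NNReal.zero_le_coe measureReal_nonneg
  · rw [eD']
    exact Finset.sum_le_sum fun q _ =>
      mul_le_of_le_one_right NNReal.zero_le_coe measureReal_le_one
  · field_simp
    ring

/-- If the clusters of `Ω` are well separated, then single-linkage clustering of the atoms of a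
mixing measure close to `Ω` recovers the clustered components of `Ω` approximately. -/
theorem exists_wasserstein_cluster_close {r : ℝ} (hr : 1 ≤ r) {Ω : MixingMeasure X}
    {α : ProbabilityMeasure X → Fin K} (hsurj : ∀ k, ∃ q ∈ Ω.atoms, α q = k) {a : ℝ}
    (hle : ∀ p ∈ Ω.atoms, ∀ q ∈ Ω.atoms, α p = α q → hellinger (p : Measure X) q ≤ a)
    (hlt : ∀ p ∈ Ω.atoms, ∀ q ∈ Ω.atoms, α p ≠ α q → a < hellinger (p : Measure X) q)
    {ε : ℝ} (hε : 0 < ε) :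
    ∃ δ > 0, ∀ Ω' : MixingMeasure X, Ω'.atoms.card = Ω.atoms.card → wasserstein r Ω' Ω < δ →
      ∀ β : ProbabilityMeasure X → Fin K,
        ((∃ β' : ProbabilityMeasure X → Fin K, IsSingleLinkage Ω' β') → IsSingleLinkage Ω' β) →
        ∃ τ : Equiv.Perm (Fin K), ∀ k, 0 < clusterWeight Ω' β (τ k) ∧
          tvDist (clusterMeasure Ω' β (τ k)) (clusterMeasure Ω α k) < ε := by
  classical
  obtain ⟨b, hb, hab⟩ := ((eventually_nhdsGT_forall_le (a := a) (Ω.atoms ×ˢ Ω.atoms)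
    (fun i => α i.1 ≠ α i.2) (fun i => hellinger (i.1 : Measure X) i.2)
    fun i hi hne => hlt _ (Finset.mem_product.1 hi).1 _ (Finset.mem_product.1 hi).2 hne).and
      self_mem_nhdsWithin).exists
  have hab : a < b := hab
  have hevk : ∀ᶠ e : ℝ in 𝓝[>] 0, ∀ k : Fin K,
      (2 * (clusterAtoms Ω α k).card / clusterWeight Ω α k + 4) * e < ε := by
    refine eventually_all.2 fun k => nhdsWithin_le_nhds ?_
    have : Tendsto (fun e : ℝ => (2 * (clusterAtoms Ω α k).card / clusterWeight Ω α k + 4) * e)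
        (𝓝 0) (𝓝 0) := by
      simpa using (continuous_const_mul
        (2 * ((clusterAtoms Ω α k).card : ℝ) / clusterWeight Ω α k + 4)).tendsto 0
    exact this.eventually_lt_const hε
  -- Matching changes distances by at most 2e < (b - a)/2, so the level (a + b)/2 still separates
  -- the clusters.
  obtain ⟨e, he, he0, heb⟩ := (hevk.and (Ioo_mem_nhdsGT (show (0 : ℝ) < (b - a) / 4 by linarith))).exists
  obtain ⟨δ, hδ, hmatch⟩ := exists_matching hr Ω he0
  refine ⟨δ, hδ, fun Ω' hcard hW β hβ => ?_⟩
  obtain ⟨φ, hinj, himage, hclose⟩ := hmatch Ω' hcard hW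
  have hne : Nonempty (ProbabilityMeasure X) := by
    by_contra hcon
    rw [not_nonempty_iff] at hcon
    have h := Ω.sum_weight
    rw [Finset.eq_empty_of_isEmpty Ω.weight.support] at h
    simp at h
  set ψ := Function.invFunOn φ (Ω.atoms : Set (ProbabilityMeasure X)) with hψ
  have hψφ : ∀ q ∈ Ω.atoms, ψ (φ q) = q := fun q hq => hinj.leftInvOn_invFunOn hq
  have htri : ∀ p ∈ Ω.atoms, ∀ q ∈ Ω.atoms,
      |hellinger (φ p : Measure X) (φ q) - hellinger (p : Measure X) q| ≤ 2 * e := by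
    intro p hp q hq
    have h1 := (hclose p hp).1
    have h2 := (hclose q hq).1
    have h3 := hellinger_triangle (φ p : Measure X) p (φ q)
    have h4 := hellinger_triangle (p : Measure X) q (φ q)
    have h5 := hellinger_triangle (p : Measure X) (φ p) q
    have h6 := hellinger_triangle (φ p : Measure X) (φ q) q
    rw [hellinger_comm (p : Measure X) (φ p)] at h5
    rw [hellinger_comm (q : Measure X) (φ q)] at h4
    exact abs_le.2 ⟨by linarith, by linarith⟩
  have hSL : IsSingleLinkage Ω' (fun p => α (ψ p)) := by
    refine isSingleLinkage_of_gap (t := (a + b) / 2) ?_ ?_ ?_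
    · intro k
      obtain ⟨q, hq, hk⟩ := hsurj k
      exact ⟨φ q, by rw [← himage]; exact Finset.mem_image_of_mem φ hq, by rw [hψφ q hq, hk]⟩
    · intro p hp q hq h
      rw [← himage] at hp hq
      obtain ⟨p, hp', rfl⟩ := Finset.mem_image.1 hp
      obtain ⟨q, hq', rfl⟩ := Finset.mem_image.1 hq
      rw [hψφ p hp', hψφ q hq'] at h
      have h1 := abs_le.1 (htri p hp' q hq')
      have h2 := hle p hp' q hq' h
      linarith
    · intro p hp q hq h
      rw [← himage] at hp hq
      obtain ⟨p, hp', rfl⟩ := Finset.mem_image.1 hp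
      obtain ⟨q, hq', rfl⟩ := Finset.mem_image.1 hq
      rw [hψφ p hp', hψφ q hq'] at h
      have h1 := abs_le.1 (htri p hp' q hq')
      have h2 := hb (p, q) (Finset.mem_product.2 ⟨hp', hq'⟩) h
      linarith
  -- The transported partition shows that a cut into `K` clusters exists, so `β` is one, and it
  -- agrees up to labels.
  have hSLβ := hβ ⟨_, hSL⟩
  obtain ⟨τ, hτ⟩ := hSL.exists_perm hSLβ
  refine ⟨τ, fun k => ?_⟩
  have hpos' : 0 < clusterWeight Ω' β (τ k) := clusterWeight_pos.2 (hSLβ.1 _)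
  refine ⟨hpos', lt_of_le_of_lt (tvDist_clusterMeasure_le (clusterWeight_pos.2 (hsurj k)) hpos'
    (hinj.mono fun q hq => (mem_clusterAtoms.1 hq).1) ?_
    fun q hq => hclose q (mem_clusterAtoms.1 hq).1) (he k)⟩
  ext p
  rw [mem_clusterAtoms, Finset.mem_image, ← himage]
  constructor
  · rintro ⟨q, hq, rfl⟩
    obtain ⟨hq, hk⟩ := mem_clusterAtoms.1 hq
    have hφq := Finset.mem_image_of_mem φ hq
    exact ⟨hφq, by rw [hτ _ (himage ▸ hφq), hψφ q hq, hk]⟩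
  · rintro ⟨hp, hk⟩
    have h1 := hτ p (himage ▸ hp)
    obtain ⟨q, hq, rfl⟩ := Finset.mem_image.1 hp
    rw [hψφ q hq, hk] at h1
    exact ⟨q, mem_clusterAtoms.2 ⟨hq, (τ.injective h1).symm⟩, rfl⟩

/-- A clustered component of a mixing measure whose atoms have continuous densities has a continuous
density, which is a convex combination of those of the atoms. -/
theorem exists_isContDensity_clusterMeasure [TopologicalSpace X] [OpensMeasurableSpace X]
    {ζ : Measure X} {Ω : MixingMeasure X} {S : Set (X → ℝ)}
    (hS : ∀ q ∈ Ω.atoms, ∃ f ∈ S, IsContDensity ζ (q : Measure X) f)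
    {α : ProbabilityMeasure X → Fin K} {k : Fin K} (hpos : 0 < clusterWeight Ω α k) :
    ∃ g ∈ convexHull ℝ S, IsContDensity ζ (clusterMeasure Ω α k) g := by
  have hS' : ∀ q : ProbabilityMeasure X, ∃ f : X → ℝ,
      q ∈ Ω.atoms → f ∈ S ∧ IsContDensity ζ (q : Measure X) f := by
    intro q
    by_cases hq : q ∈ Ω.atoms
    · obtain ⟨f, hf⟩ := hS q hq
      exact ⟨f, fun _ => hf⟩
    · exact ⟨0, fun h => absurd h hq⟩
  choose f hf using hS'
  have hmem := Finset.centerMass_mem_convexHull (R := ℝ) (s := S) (clusterAtoms Ω α k)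
    (w := fun q => (Ω.weight q : ℝ)) (z := f) (fun q _ => NNReal.zero_le_coe)
    (by rw [← NNReal.coe_sum]; exact_mod_cast hpos)
    (fun q hq => (hf q (mem_clusterAtoms.1 hq).1).1)
  refine ⟨_, hmem, ?_⟩
  rw [Finset.centerMass, ← NNReal.coe_sum, ← NNReal.coe_inv]
  exact (IsContDensity.sum _ fun q hq =>
    (hf q (mem_clusterAtoms.1 hq).1).2.smul (Ω.weight q)).smul _

end Clusters

/-- Minimizing the worst entry yields one relabelling for all ε, whereas the stability estimate
provides one for each ε. -/
theorem exists_perm_minimizing {K : ℕ} (d : Fin K → Fin K → ℝ) : ∃ τ : Equiv.Perm (Fin K),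
    ∀ ε, (∃ σ : Equiv.Perm (Fin K), ∀ k, d (σ k) k < ε) → ∀ k, d (τ k) k < ε := by
  obtain ⟨τ, hτ⟩ := Finite.exists_min fun σ : Equiv.Perm (Fin K) => ⨆ k, d (σ k) k
  refine ⟨τ, fun ε ⟨σ, hσ⟩ k => ?_⟩
  have : Nonempty (Fin K) := ⟨k⟩
  obtain ⟨l, hl⟩ := exists_eq_ciSup_of_finite (f := fun k => d (σ k) k)
  calc d (τ k) k ≤ ⨆ k, d (τ k) k :=
        le_ciSup (f := fun k => d (τ k) k) (Set.finite_range _).bddAbove k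
    _ ≤ ⨆ k, d (σ k) k := hτ σ
    _ < ε := hl ▸ hσ l

/-! ### Regular assignment sequences as `L` tends to infinity -/

section Regular

variable {K : ℕ} {𝔔 : ℕ → Set (MixingMeasure X)} {Λ : MixingMeasure X}
  {γ : Fin K → ProbabilityMeasure X} {Ωs : ℕ → MixingMeasure X}
  {α : ℕ → ProbabilityMeasure X → Fin K}

theorem IsRegularWith.eventually_mem (hreg : IsRegularWith 𝔔 Λ γ Ωs α) :
    ∀ᶠ L in atTop, Ωs L ∈ 𝔔 L :=
  hreg.proj.mono fun _ h => h.1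

theorem IsRegularWith.eventually_clusterWeight_pos (hreg : IsRegularWith 𝔔 Λ γ Ωs α)
    (hγ : IsEnumeration Λ γ) : ∀ᶠ L in atTop, ∀ k, 0 < clusterWeight (Ωs L) (α L) k := by
  refine eventually_all.2 fun k => (hreg.weight_tendsto k).eventually_const_lt ?_
  have hk : γ k ∈ (Λ.atoms : Set (ProbabilityMeasure X)) := hγ.2 ▸ Set.mem_range_self k
  exact MixingMeasure.weight_pos hk

theorem IsRegularWith.tendsto_tvDist (hreg : IsRegularWith 𝔔 Λ γ Ωs α)
    (hγ : IsEnumeration Λ γ) (k : Fin K) :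
    Tendsto (fun L => tvDist (clusterMeasure (Ωs L) (α L) k) (γ k)) atTop (𝓝 0) := by
  have h := (hreg.component_tendsto k).const_mul 4
  rw [mul_zero] at h
  refine squeeze_zero' (Eventually.of_forall fun _ => tvDist_nonneg _ _) ?_ h
  -- The comparison with ρ needs probability measures, hence nonempty clusters, which hold only for
  -- large `L`.
  filter_upwards [hreg.eventually_clusterWeight_pos hγ] with L hL
  have := isProbabilityMeasure_clusterMeasure (hL k)
  exact tvDist_le_hellinger _ _

theorem eventually_four_mul_eta_lt (hγ : IsEnumeration Λ γ) {ξ : ℝ} (hξ : 0 < ξ)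
    (hsep : IsSeparated Λ ((4 + ξ) * limsup (fun L => eta γ (Ωs L) (α L)) atTop)) :
    ∀ᶠ L in atTop, ∀ i j, i ≠ j →
      4 * eta γ (Ωs L) (α L) < hellinger (γ i : Measure X) (γ j) := by
  refine eventually_all.2 fun i => eventually_all.2 fun j => ?_
  by_cases hij : i = j
  · exact Eventually.of_forall fun _ h => absurd hij h
  have hmem : ∀ k, γ k ∈ Λ.atoms := fun k => by
    have hk : γ k ∈ (Λ.atoms : Set (ProbabilityMeasure X)) := hγ.2 ▸ Set.mem_range_self k
    exact hk
  have hbdd : IsBoundedUnder (· ≤ ·) atTop fun L => eta γ (Ωs L) (α L) :=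
    isBoundedUnder_of ⟨2, fun L => eta_le_two γ (Ωs L) (α L)⟩
  have h0 : 0 ≤ limsup (fun L => eta γ (Ωs L) (α L)) atTop :=
    le_limsup_of_frequently_le (Frequently.of_forall fun L => eta_nonneg γ (Ωs L) (α L)) hbdd
  have h1 := hsep _ (hmem i) _ (hmem j) fun h => hij (hγ.1 h)
  -- Nonnegativity of the limsup allows ξ to be dropped; the inequality stays strict, so it passes
  -- to all large `L`.
  have h2 : limsup (fun L => eta γ (Ωs L) (α L)) atTop <
      hellinger (γ i : Measure X) (γ j) / 4 := by
    nlinarith [mul_nonneg hξ.le h0]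
  filter_upwards [eventually_lt_of_limsup_lt h2 hbdd] with L hL _
  linarith

/-- The estimated clustered components converge in total variation. -/
theorem eventually_exists_wasserstein_component_close (hreg : IsRegularWith 𝔔 Λ γ Ωs α)
    (hγ : IsEnumeration Λ γ) {ξ : ℝ} (hξ : 0 < ξ)
    (hsep : IsSeparated Λ ((4 + ξ) * limsup (fun L => eta γ (Ωs L) (α L)) atTop))
    {r : ℝ} (hr : 1 ≤ r) {ε : ℝ} (hε : 0 < ε) :
    ∀ᶠ L in atTop, ∃ δ > 0, ∀ Ω' : MixingMeasure X, Ω'.atoms.card = (Ωs L).atoms.card →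
      wasserstein r Ω' (Ωs L) < δ → ∀ β : ProbabilityMeasure X → Fin K,
        ((∃ β' : ProbabilityMeasure X → Fin K, IsSingleLinkage Ω' β') → IsSingleLinkage Ω' β) →
        ∃ τ : Equiv.Perm (Fin K), ∀ k, 0 < clusterWeight Ω' β (τ k) ∧
          tvDist (clusterMeasure Ω' β (τ k)) (γ k) < ε := by
  have htv : ∀ᶠ L in atTop, ∀ k, tvDist (clusterMeasure (Ωs L) (α L) k) (γ k) < ε / 2 :=
    eventually_all.2 fun k => (hreg.tendsto_tvDist hγ k).eventually_lt_const (half_pos hε)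
  filter_upwards [htv, hreg.eventually_clusterWeight_pos hγ,
    eventually_four_mul_eta_lt hγ hξ hsep] with L hL hpos hgap
  obtain ⟨δ, hδ, h⟩ := exists_wasserstein_cluster_close hr
    (fun k => clusterWeight_pos.1 (hpos k))
    (fun p hp q hq => hellinger_le_eta_of_same_cluster γ hp hq)
    (fun p hp q hq => lt_hellinger_of_different_cluster hgap hp hq) (half_pos hε)
  refine ⟨δ, hδ, fun Ω' hcard hW β hβ => ?_⟩
  obtain ⟨τ, hτ⟩ := h Ω' hcard hW β hβ
  refine ⟨τ, fun k => ⟨(hτ k).1, ?_⟩⟩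
  have h1 := tvDist_triangle (clusterMeasure Ω' β (τ k)) (clusterMeasure (Ωs L) (α L) k) (γ k)
  have h2 := (hτ k).2
  have h3 := hL k
  linarith

variable [TopologicalSpace X] {ζ : Measure X}

/-- The set of the continuous densities of all atoms occurring in the families `𝔔_L`. -/
def atomDensities (ζ : Measure X) (𝔔 : ℕ → Set (MixingMeasure X)) : Set (X → ℝ) :=
  {f : X → ℝ | ∃ L, ∃ Ω ∈ 𝔔 L, ∃ q ∈ Ω.atoms, IsContDensity ζ (q : Measure X) f}

theorem IsEquicontinuousFamily.exists_density (h : IsEquicontinuousFamily ζ 𝔔) {L : ℕ}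
    {Ω : MixingMeasure X} (hΩ : Ω ∈ 𝔔 L) :
    ∀ q ∈ Ω.atoms, ∃ f ∈ atomDensities ζ 𝔔, IsContDensity ζ (q : Measure X) f := by
  intro q hq
  obtain ⟨f, hf⟩ := h.1 L Ω hΩ q hq
  exact ⟨f, ⟨L, Ω, hΩ, q, hq, hf⟩, hf⟩

variable [OpensMeasurableSpace X]

theorem IsRegularWith.exists_isContDensity [ζ.IsOpenPosMeasure]
    (hreg : IsRegularWith 𝔔 Λ γ Ωs α) (hγ : IsEnumeration Λ γ)
    (hequi : IsEquicontinuousFamily ζ 𝔔) (k : Fin K) :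
    ∃ f, IsContDensity ζ (γ k : Measure X) f := by
  obtain ⟨N, hN⟩ := eventually_atTop.1
    (hreg.eventually_mem.and (hreg.eventually_clusterWeight_pos hγ))
  have h : ∀ n, ∃ g ∈ convexHull ℝ (atomDensities ζ 𝔔),
      IsContDensity ζ (clusterMeasure (Ωs (n + N)) (α (n + N)) k) g := fun n =>
    exists_isContDensity_clusterMeasure (hequi.exists_density (hN _ (Nat.le_add_left N n)).1)
      ((hN _ (Nat.le_add_left N n)).2 k)
  choose g hgS hg using h
  exact exists_isContDensity_of_tendsto (equicontinuous_convexHull hequi.2) hgS hg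
    ((hreg.tendsto_tvDist hγ k).comp (tendsto_add_atTop_nat N))

end Regular

end NPMix

end

/-! ### Locally uniform convergence of the estimated densities -/

theorem mainTheorem6
    {X : Type*} [MetricSpace X] [MeasurableSpace X] [BorelSpace X]
    -- base measure of full support
    (ζ : Measure X) [ζ.IsOpenPosMeasure]
    -- order of the Wasserstein distance
    (r : ℝ) (hr : 1 ≤ r)
    -- approximating families
    (𝔔 : ℕ → Set (NPMix.MixingMeasure X)) (h𝔔 : NPMix.IsApproximatingFamily 𝔔)
    -- a regular mixing measure with atoms `γ`, its projections `Ωs`, a regular assignment sequence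
    {K : ℕ} (Λ : NPMix.MixingMeasure X) (γ : Fin K → ProbabilityMeasure X)
    (hγ : NPMix.IsEnumeration Λ γ)
    (Ωs : ℕ → NPMix.MixingMeasure X) (α : ℕ → ProbabilityMeasure X → Fin K)
    (hreg : NPMix.IsRegularWith 𝔔 Λ γ Ωs α)
    -- separation
    (ξ : ℝ) (hξ : 0 < ξ)
    (hsep : NPMix.IsSeparated Λ ((4 + ξ) * limsup (fun L => NPMix.eta γ (Ωs L) (α L)) atTop))
    -- the i.i.d. sample from `m(Λ)`
    {Ξ : Type*} [MeasurableSpace Ξ] (P : Measure Ξ) [IsProbabilityMeasure P]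
    (Z : ℕ → Ξ → X) (hZindep : iIndepFun Z P) (hZlaw : ∀ i, HasLaw (Z i) Λ.mix P)
    -- the estimators of the projections, with the same number of atoms as the projections
    (Ωhat : ℕ → (n : ℕ) → (Fin n → X) → NPMix.MixingMeasure X)
    (hΩhat : ∀ᶠ L in atTop, ∀ n z,
      Ωhat L n z ∈ 𝔔 L ∧ (Ωhat L n z).atoms.card = (Ωs L).atoms.card)
    -- the estimated assignments, by single-linkage clustering into `K` clusters
    (αhat : ℕ → (n : ℕ) → (Fin n → X) → ProbabilityMeasure X → Fin K)
    (hαhat : ∀ L n z, (∃ β : ProbabilityMeasure X → Fin K,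
      NPMix.IsSingleLinkage (Ωhat L n z) β) → NPMix.IsSingleLinkage (Ωhat L n z) (αhat L n z))
    -- equicontinuity
    (hequi : NPMix.IsEquicontinuousFamily ζ 𝔔) :
    -- each component has a continuous density
    (∀ k, ∃ f, NPMix.IsContDensity ζ (γ k : Measure X) f) ∧
    -- the clusters can be relabelled so that the following holds for the densities
    ∃ τ : ℕ → (n : ℕ) → (Fin n → X) → Equiv.Perm (Fin K),
      let fhat : ℕ × ℕ → Ξ → Fin K → X → ℝ := fun p ω k =>
        let z : Fin p.2 → X := fun i => Z i ω
        NPMix.contDensity ζ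
          (NPMix.clusterMeasure (Ωhat p.1 p.2 z) (αhat p.1 p.2 z) (τ p.1 p.2 z k))
      let f : Fin K → X → ℝ := fun k => NPMix.contDensity ζ (γ k : Measure X)
      -- almost sure version
      ((∀ᶠ L in atTop, ∀ᵐ ω ∂P,
          Tendsto (fun n => NPMix.wasserstein r (Ωhat L n fun i => Z i ω) (Ωs L)) atTop (𝓝 0)) →
        ∀ᵐ ω ∂P, ∀ k,
          (∀ x, Tendsto (fun p => fhat p ω k x) (atTop.curry atTop) (𝓝 (f k x))) ∧
          ∀ C, IsCompact C →
            TendstoUniformlyOn (fun p => fhat p ω k) (f k) (atTop.curry atTop) C) ∧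
      -- version in probability
      ((∀ᶠ L in atTop, ∀ ε : ℝ, 0 < ε → Tendsto (fun n =>
          P {ω | ε ≤ NPMix.wasserstein r (Ωhat L n fun i => Z i ω) (Ωs L)}) atTop (𝓝 0)) →
        ∀ k,
          (∀ x, ∀ ε : ℝ, 0 < ε → Tendsto (fun p => P {ω | ε ≤ |fhat p ω k x - f k x|})
            (atTop.curry atTop) (𝓝 0)) ∧
          ∀ C, IsCompact C → ∀ ε : ℝ, 0 < ε →
            Tendsto (fun p => P {ω | ∃ x ∈ C, ε ≤ |fhat p ω k x - f k x|})
              (atTop.curry atTop) (𝓝 0)) := by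
  classical
  have hdens := hreg.exists_isContDensity (ζ := ζ) hγ hequi
  refine ⟨hdens, ?_⟩
  choose τ hτ using fun L n (z : Fin n → X) => NPMix.exists_perm_minimizing fun l k =>
    NPMix.tvDist (NPMix.clusterMeasure (Ωhat L n z) (αhat L n z) l) (γ k)
  -- The deterministic core: `δ` depends on `L`, ε and the compact set, but not on `n` or the data.
  have hclose : ∀ k, ∀ C, IsCompact C → ∀ ε : ℝ, 0 < ε → ∀ᶠ L in atTop, ∃ δ > 0, ∀ n z,
      NPMix.wasserstein r (Ωhat L n z) (Ωs L) < δ → ∀ x ∈ C,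
        |NPMix.contDensity ζ (NPMix.clusterMeasure (Ωhat L n z) (αhat L n z) (τ L n z k)) x -
          NPMix.contDensity ζ (γ k : Measure X) x| < ε := by
    intro k C hC ε hε
    have hf := NPMix.isContDensity_contDensity (hdens k)
    obtain ⟨η, hη, h⟩ := NPMix.exists_density_close_of_isCompact (ζ := ζ)
      (NPMix.equicontinuous_insert (NPMix.equicontinuous_convexHull hequi.2) hf.continuous) hC hε
    filter_upwards [hΩhat,
      NPMix.eventually_exists_wasserstein_component_close hreg hγ hξ hsep hr hη]
      with L hL ⟨δ, hδ, hLδ⟩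
    refine ⟨δ, hδ, fun n z hW => ?_⟩
    obtain ⟨σ, hσ⟩ := hLδ _ (hL n z).2 hW _ (hαhat L n z)
    -- Every label is a value of `σ`, so the cluster selected by `τ` is nonempty as well.
    have hpos : 0 < NPMix.clusterWeight (Ωhat L n z) (αhat L n z) (τ L n z k) := by
      simpa using (hσ (σ.symm (τ L n z k))).1
    obtain ⟨g, hgS, hg⟩ := NPMix.exists_isContDensity_clusterMeasure
      (hequi.exists_density (hL n z).1) hpos
    rw [← hg.eq_contDensity]
    exact h _ _ g (Set.mem_insert_of_mem _ hgS) _ (Set.mem_insert _ _) hg hf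
      (hτ L n z η ⟨σ, fun k => (hσ k).2⟩ k)
  refine ⟨τ, ?_⟩
  intro fhat f
  constructor
  · intro hW
    obtain ⟨L₀, hL₀⟩ := eventually_atTop.1 hW
    -- Countably many `L` share a single null set, outside which the iterated limit is taken.
    have hae : ∀ᵐ ω ∂P, ∀ L, L₀ ≤ L → Tendsto (fun n =>
        NPMix.wasserstein r (Ωhat L n fun i => Z i ω) (Ωs L)) atTop (𝓝 0) :=
      ae_all_iff.2 fun L => by
        by_cases hL : L₀ ≤ L
        · filter_upwards [hL₀ L hL] with ω hω _
          exact hω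
        · exact Eventually.of_forall fun _ h => absurd h hL
    filter_upwards [hae] with ω hω k
    have hunif : ∀ C, IsCompact C →
        TendstoUniformlyOn (fun p => fhat p ω k) (f k) (atTop.curry atTop) C := by
      intro C hC
      refine Metric.tendstoUniformlyOn_iff.2 fun ε hε => eventually_curry_iff.2 ?_
      filter_upwards [hclose k C hC ε hε, eventually_ge_atTop L₀] with L ⟨δ, hδ, h⟩ hL
      filter_upwards [(hω L hL).eventually_lt_const hδ] with n hn x hx
      rw [dist_comm]
      exact h n _ hn x hx
    exact ⟨fun x => (hunif {x} isCompact_singleton).tendsto_at (Set.mem_singleton x), hunif⟩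
  · intro hW k
    have hunif : ∀ C, IsCompact C → ∀ ε : ℝ, 0 < ε →
        Tendsto (fun p => P {ω | ∃ x ∈ C, ε ≤ |fhat p ω k x - f k x|})
          (atTop.curry atTop) (𝓝 0) := by
      intro C hC ε hε
      refine ENNReal.tendsto_nhds_zero.2 fun e he => eventually_curry_iff.2 ?_
      filter_upwards [hclose k C hC ε hε, hW] with L ⟨δ, hδ, h⟩ hL
      filter_upwards [ENNReal.tendsto_nhds_zero.1 (hL δ hδ) e he] with n hn
      -- A density error of at least ε forces W_r ≥ δ. Monotonicity suffices, so the measurability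
      -- of these events plays no role.
      refine (measure_mono ?_).trans hn
      rintro ω ⟨x, hx, hxε⟩
      by_contra hlt
      exact absurd (h n _ (not_le.1 hlt) x hx) (not_lt.2 hxε)
    refine ⟨fun x ε hε => ?_, hunif⟩
    simpa using hunif {x} isCompact_singleton ε hε
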